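/- Let $G$ be a finite group, let $p$ be a prime number dividing $|G|$, and let $P$ be a Sylow $p$-subgroup of $G$. Let $\mathcal{A}_p(G)$ be the poset of non-trivial elementary abelian $p$-subgroups of $G$, ordered by inclusion, on which $G$ acts by conjugation. Let $\mathcal{A}_p(G)'$ be the poset of non-empty chains of $\mathcal{A}_p(G)$, ordered by inclusion, with the induced action of $G$, and let $\mathcal{A}_p(G)'/G$ be its set of orbits, with the partial order in which $\overline{c}\leq\overline{d}$ if and only if there are $c_0\in\overline{c}$ and $d_0\in\overline{d}$ with $c_0\subseteq d_0$. Regard $\mathcal{A}_p(G)'/G$ as a topological space whose open sets are the down-sets of this order. If $|P|\leq p^4$, then $\mathcal{A}_p(G)'/G$ is a finite space which is contractible (i.e. homotopy equivalent to a point). -/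

import Mathlib

open scoped Pointwise
open PartialOrder

namespace OrbitPosets

section Chains

variable {M X : Type*} [Group M] [PartialOrder X] [MulAction M X]
  [CovariantClass M X (· • ·) (· ≤ ·)]

/-- Translation by `g` as a monotone map of a poset with an order-preserving action. -/
def smulHom (g : M) : X →o X where
  toFun x := g • x
  monotone' _ _ h := CovariantClass.elim g h

/-- The action on the subdivision `X'`, the poset of non-empty finite chains of `X` ordered by
inclusion: `g • (x₀ < ⋯ < xₙ) = (g • x₀ < ⋯ < g • xₙ)`. -/
noncomputable instance : MulAction M (NonemptyFiniteChains X) where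
  smul g c := c.map (smulHom g)
  one_smul c := by
    apply NonemptyFiniteChains.ext
    ext x
    change x ∈ (c.map (smulHom (1 : M))).finset ↔ _
    simp [smulHom]
  mul_smul g h c := by
    apply NonemptyFiniteChains.ext
    ext x
    change x ∈ (c.map (smulHom (g * h))).finset ↔
      x ∈ ((c.map (smulHom h)).map (smulHom g)).finset
    simp only [NonemptyFiniteChains.mem_map_iff]
    constructor
    · rintro ⟨y, hy, rfl⟩
      exact ⟨h • y, ⟨y, hy, rfl⟩, (mul_smul g h y).symm⟩
    · rintro ⟨_, ⟨y, hy, rfl⟩, rfl⟩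
      exact ⟨y, hy, mul_smul g h y⟩

theorem mem_smul_chain (g : M) (c : NonemptyFiniteChains X) (x : X) :
    x ∈ (g • c).finset ↔ ∃ y ∈ c.finset, g • y = x :=
  NonemptyFiniteChains.mem_map_iff c (smulHom g) x

instance : CovariantClass M (NonemptyFiniteChains X) (· • ·) (· ≤ ·) where
  elim g _ _ h := (NonemptyFiniteChains.orderHomMap (smulHom g)).monotone h

end Chains

/-- The set `X / M` of orbits. -/
def OrbitPoset (M X : Type*) [Group M] [MulAction M X] : Type _ :=
  MulAction.orbitRel.Quotient M X

/-- The orbit of a point. -/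
def OrbitPoset.mk (M : Type*) {X : Type*} [Group M] [MulAction M X] (x : X) : OrbitPoset M X :=
  Quotient.mk (MulAction.orbitRel M X) x

theorem OrbitPoset.mk_eq_mk {M X : Type*} [Group M] [MulAction M X] {x y : X} :
    OrbitPoset.mk M x = OrbitPoset.mk M y ↔ ∃ g : M, g • y = x :=
  Quotient.eq (r := MulAction.orbitRel M X)

section Orbits

variable {M X : Type*} [Group M] [PartialOrder X] [MulAction M X]
  [CovariantClass M X (· • ·) (· ≤ ·)]

theorem smul_eq_of_le_smul [Finite M] {g : M} {x : X} (h : x ≤ g • x) : g • x = x := by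
  have key : ∀ n : ℕ, g • x ≤ g ^ (n + 1) • x := by
    intro n
    induction n with
    | zero => simp
    | succ n ih =>
      have := (smulHom g).monotone ih
      change g • (g • x) ≤ g • (g ^ (n + 1) • x) at this
      rw [← mul_smul g (g ^ (n + 1)), ← pow_succ'] at this
      exact ((smulHom g).monotone h).trans this
  have hpos := orderOf_pos g
  have := key (orderOf g - 1)
  rw [Nat.sub_add_cancel hpos, pow_orderOf_eq_one, one_smul] at this
  exact le_antisymm this h

/-- The order on the orbit set: `a ≤ b` when some element of the orbit `a` lies below some element
of the orbit `b`. -/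
instance [Finite M] : PartialOrder (OrbitPoset M X) where
  le a b := ∃ x y : X, OrbitPoset.mk M x = a ∧ OrbitPoset.mk M y = b ∧ x ≤ y
  le_refl a := by
    obtain ⟨x, rfl⟩ := Quotient.exists_rep a
    exact ⟨x, x, rfl, rfl, le_rfl⟩
  le_trans := by
    rintro _ _ _ ⟨x, y, rfl, rfl, hxy⟩ ⟨y', z, hy, rfl, hyz⟩
    obtain ⟨g, rfl⟩ := OrbitPoset.mk_eq_mk.1 hy
    refine ⟨g • x, z, OrbitPoset.mk_eq_mk.2 ⟨g, rfl⟩, rfl, ?_⟩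
    exact ((smulHom g).monotone hxy).trans hyz
  le_antisymm := by
    rintro _ _ ⟨x, y, rfl, rfl, hxy⟩ ⟨y', x', hy, hx, hyx⟩
    obtain ⟨g, rfl⟩ := OrbitPoset.mk_eq_mk.1 hy
    obtain ⟨h, rfl⟩ := OrbitPoset.mk_eq_mk.1 hx
    have h1 : g • x ≤ g • y := (smulHom g).monotone hxy
    have h2 : y ≤ (g⁻¹ * h) • x := by
      have := (smulHom g⁻¹).monotone hyx
      change g⁻¹ • g • y ≤ g⁻¹ • h • x at this
      rwa [inv_smul_smul, ← mul_smul] at this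
    have h3 : (g⁻¹ * h) • x = x := smul_eq_of_le_smul (hxy.trans h2)
    rw [h3] at h2
    rw [le_antisymm hxy h2]

end Orbits

/-- A subgroup is an elementary abelian `p`-group: it is abelian and all its elements satisfy
`x ^ p = 1`. -/
structure IsElementaryAbelian {G : Type*} [Group G] (p : ℕ) (A : Subgroup G) : Prop where
  comm : ∀ x ∈ A, ∀ y ∈ A, x * y = y * x
  pow_eq_one : ∀ x ∈ A, x ^ p = 1

theorem IsElementaryAbelian.smul {G : Type*} [Group G] {p : ℕ} {A : Subgroup G}
    (hA : IsElementaryAbelian p A) (g : ConjAct G) : IsElementaryAbelian p (g • A) where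
  comm := by
    intro x hx y hy
    obtain ⟨a, ha, rfl⟩ := Subgroup.mem_smul_pointwise_iff_exists _ _ _ |>.1 hx
    obtain ⟨b, hb, rfl⟩ := Subgroup.mem_smul_pointwise_iff_exists _ _ _ |>.1 hy
    rw [← smul_mul', hA.comm a ha b hb, smul_mul']
  pow_eq_one := by
    intro x hx
    obtain ⟨a, ha, rfl⟩ := Subgroup.mem_smul_pointwise_iff_exists _ _ _ |>.1 hx
    rw [← smul_pow', hA.pow_eq_one a ha, smul_one]

/-- `𝒜_p(G)`: the poset of non-trivial elementary abelian `p`-subgroups of `G`, ordered by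
inclusion. -/
abbrev ElementaryAbelianPoset (p : ℕ) (G : Type*) [Group G] : Type _ :=
  {A : Subgroup G // A ≠ ⊥ ∧ IsElementaryAbelian p A}

section Conjugation

variable {G : Type*} [Group G] {p : ℕ}

/-- The conjugation action of `G` on `𝒜_p(G)`, written on the left as `g • A = g A g⁻¹`; its orbits
are those of the right action `A ↦ g⁻¹ A g`. -/
instance : MulAction (ConjAct G) (ElementaryAbelianPoset p G) where
  smul g A := ⟨g • A.1, fun h => A.2.1 (by
    have := congrArg (fun B => g⁻¹ • B) h
    simpa using this), A.2.2.smul g⟩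
  one_smul A := Subtype.ext (one_smul _ A.1)
  mul_smul g h A := Subtype.ext (mul_smul g h A.1)

theorem coe_smul (g : ConjAct G) (A : ElementaryAbelianPoset p G) :
    ((g • A : ElementaryAbelianPoset p G) : Subgroup G) = g • (A : Subgroup G) := rfl

instance : CovariantClass (ConjAct G) (ElementaryAbelianPoset p G) (· • ·) (· ≤ ·) where
  elim g _ _ h := Subgroup.pointwise_smul_le_pointwise_smul_iff (a := g).2 h

end Conjugation

instance {G : Type*} [Group G] [Finite G] : Finite (ConjAct G) := ‹Finite G›

/-- The finite space `𝒜_p(G)' / G`: the orbit poset of the subdivision of `𝒜_p(G)` under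
conjugation, with the topology whose open sets are the down-sets. -/
abbrev SubdivisionOrbitSpace (p : ℕ) (G : Type*) [Group G] [Finite G] : Type _ :=
  Topology.WithLowerSet
    (OrbitPoset (ConjAct G) (NonemptyFiniteChains (ElementaryAbelianPoset p G)))

end OrbitPosets

/-!
The finite space `𝒜_p(G)'/G` is contracted by a sequence of retractions, each relating comparable
monotone maps (`contractibleSpace_of_comparable`). There are two kinds of retraction: inserting into
a chain a subgroup that is unique up to the elements of `G` normalizing every member of the chain
(`HasContractibleOrbits.of_insert`), and deleting the members of a chain that lack some property
(`HasContractibleOrbits.of_filter`).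

Let `Z_Q = Ω₁(Z(Q))` for a Sylow `p`-subgroup `Q`, and let `z` be the common order of these groups.
The retractions are governed by a family `𝓜` of elementary abelian subgroups
(`IsControllingFamily`) such that the members of `𝓜` above a subgroup `C` are conjugate under the
centralizer of `C`, such that every `Z_Q` lies in a member of `𝓜`, and such that an elementary
abelian subgroup in no member of `𝓜`, called outside, has order at most `p * z`, with conditions on
how it meets the groups `Z_Q` when its order is exactly `p * z`. For an outside subgroup `C ≤ Q`,
the product `C * Z_Q` has order exactly `p * z` and is unique up to conjugation by the centralizer
of `C`; inserting it, and then deleting the smaller outside subgroups, leaves at most one outside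
subgroup `E` in each chain. The subgroups `Z_Q` of `E` are the fixed points of
Sylow subgroups of the normalizer of `E`, hence are conjugate (`exists_conj_omegaCenter_eq`), so one
of them can be inserted and `E` deleted. The remaining chains lie in members of `𝓜`; adding such a
member on top contracts them to the orbit `𝓜`
(`IsControllingFamily.hasContractibleOrbits_univ`).

For Sylow subgroups of order at most `p ^ 4` a controlling family always exists
(`exists_isControllingFamily`). If all elementary abelian subgroups have order at most `p * z`, the
groups `Z_Q` form one. Otherwise `|Q| = p ^ 4` and `z = p`, and `Q` contains an elementary abelian
subgroup of order `p ^ 3`; this subgroup is unique in `Q`, and the subgroups of this kind form a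
controlling family.
-/

namespace OrbitPosets

/-! ### Homotopies between monotone maps of finite spaces -/

section Homotopy

open Topology

variable {α β : Type*} [Preorder α] [Preorder β]

/-- Pointwise comparable monotone maps are homotopic for the down-set topologies. -/
theorem homotopic_of_le (f g : α →o β) (h : ∀ a, f a ≤ g a) :
    (WithLowerSet.map f).Homotopic (WithLowerSet.map g) := by
  classical
  let F : unitInterval × WithLowerSet α → WithLowerSet β := fun q =>
    if q.1 = 1 then WithLowerSet.map g q.2 else WithLowerSet.map f q.2
  have hF : Continuous F := by
    refine continuous_def.2 fun U hU => ?_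
    have hlow := IsLowerSet.isOpen_iff_isLowerSet.1 hU
    -- The larger map is used only at the endpoint, so openness reduces to two product sets.
    have hpre : F ⁻¹' U = ({1}ᶜ ×ˢ (WithLowerSet.map f ⁻¹' U)) ∪
        (Set.univ ×ˢ (WithLowerSet.map g ⁻¹' U)) := by
      ext ⟨t, a⟩
      have hfg : WithLowerSet.map g a ∈ U → WithLowerSet.map f a ∈ U :=
        fun hg => hlow (h a) hg
      by_cases ht : t = 1 <;> simp [F, ht]
      exact hfg
    rw [hpre]
    exact (isOpen_compl_singleton.prod (hU.preimage (map_continuous _))).union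
      (isOpen_univ.prod (hU.preimage (map_continuous _)))
  exact ⟨{ toFun := F
           continuous_toFun := hF
           map_zero_left := fun a => by simp [F]
           map_one_left := fun a => by simp [F] }⟩

theorem homotopic_of_le_or_ge (f g : α →o β) (h : (∀ a, f a ≤ g a) ∨ ∀ a, g a ≤ f a) :
    (WithLowerSet.map f).Homotopic (WithLowerSet.map g) :=
  h.elim (homotopic_of_le f g) fun h => (homotopic_of_le g f h).symm

/-- Two posets related by monotone maps whose composites are comparable with the identities have
homotopy equivalent spaces of down-sets, so that contractibility passes from one to the other. -/
theorem contractibleSpace_of_comparable (f : α →o β) (i : β →o α)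
    (hα : (∀ a, i (f a) ≤ a) ∨ ∀ a, a ≤ i (f a)) (hβ : (∀ b, f (i b) ≤ b) ∨ ∀ b, b ≤ f (i b))
    (hcontr : ContractibleSpace (WithLowerSet β)) : ContractibleSpace (WithLowerSet α) :=
  ContinuousMap.HomotopyEquiv.contractibleSpace
    { toFun := WithLowerSet.map f
      invFun := WithLowerSet.map i
      left_inv := homotopic_of_le_or_ge (i.comp f) OrderHom.id hα
      right_inv := homotopic_of_le_or_ge (f.comp i) OrderHom.id hβ }

theorem contractibleSpace_of_least (a : α) (h : ∀ b, a ≤ b) :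
    ContractibleSpace (WithLowerSet α) := by
  rw [contractible_iff_id_nullhomotopic]
  exact ⟨WithLowerSet.toLowerSet a,
    (homotopic_of_le (OrderHom.const α a) OrderHom.id h).symm⟩

end Homotopy

/-! ### Retractions of orbit posets -/

theorem OrbitPoset.mk_smul {M Y : Type*} [Group M] [MulAction M Y] (g : M) (y : Y) :
    OrbitPoset.mk M (g • y) = OrbitPoset.mk M y :=
  OrbitPoset.mk_eq_mk.2 ⟨g, rfl⟩

section OrbitRetractions

variable {M Y : Type*} [Group M] [Finite M] [PartialOrder Y] [MulAction M Y]
  [CovariantClass M Y (· • ·) (· ≤ ·)]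

variable (M) in
/-- The orbits meeting `S`, as a subspace of the finite space of orbits, is contractible. -/
def HasContractibleOrbits (S : Set Y) : Prop :=
  ContractibleSpace (Topology.WithLowerSet (OrbitPoset.mk M '' S))

theorem OrbitPoset.mk_mono {x y : Y} (h : x ≤ y) : OrbitPoset.mk M x ≤ OrbitPoset.mk M y :=
  ⟨x, y, rfl, rfl, h⟩

theorem OrbitPoset.exists_le_smul {x y : Y} (h : OrbitPoset.mk M x ≤ OrbitPoset.mk M y) :
    ∃ g : M, x ≤ g • y := by
  obtain ⟨x', y', hx, hy, hxy⟩ := h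
  obtain ⟨a, rfl⟩ := OrbitPoset.mk_eq_mk.1 hx
  obtain ⟨b, rfl⟩ := OrbitPoset.mk_eq_mk.1 hy
  refine ⟨a⁻¹ * b, ?_⟩
  have := (smulHom a⁻¹).monotone hxy
  change a⁻¹ • a • x ≤ a⁻¹ • b • y at this
  rwa [inv_smul_smul, ← mul_smul] at this

/-- An equivariant relation that is single-valued and monotone on orbits, and always increasing
or always decreasing, retracts the orbits of `S` onto those of `T`. -/
theorem HasContractibleOrbits.of_relation {S T : Set Y} (hTS : T ⊆ S) (R : Y → Y → Prop)
    (hsmul : ∀ (g : M) c d, R c d → R (g • c) (g • d))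
    (hex : ∀ c ∈ S, ∃ d ∈ T, R c d)
    (hmono : ∀ c ∈ S, ∀ c' d d', c ≤ c' → R c d → R c' d' →
      OrbitPoset.mk M d ≤ OrbitPoset.mk M d')
    (hcomp : (∀ c d, R c d → d ≤ c) ∨ ∀ c d, R c d → c ≤ d)
    (hT : HasContractibleOrbits M T) : HasContractibleOrbits M S := by
  choose r hr using fun o : OrbitPoset.mk M '' S => o.2
  choose t ht hrt using fun o => hex (r o) (hr o).1
  let f : (OrbitPoset.mk M '' S) →o (OrbitPoset.mk M '' T) :=
    { toFun := fun o => ⟨OrbitPoset.mk M (t o), t o, ht o, rfl⟩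
      monotone' := by
        intro o o' hle
        have hle' : OrbitPoset.mk M (r o) ≤ OrbitPoset.mk M (r o') := by
          rw [(hr o).2, (hr o').2]; exact hle
        obtain ⟨g, hg⟩ := OrbitPoset.exists_le_smul hle'
        have := hmono _ (hr o).1 _ _ _ hg (hrt o) (hsmul g _ _ (hrt o'))
        rw [OrbitPoset.mk_smul] at this
        exact this }
  let i : (OrbitPoset.mk M '' T) →o (OrbitPoset.mk M '' S) :=
    { toFun := fun o => ⟨o.1, Set.image_mono hTS o.2⟩
      monotone' := fun _ _ h => h }
  have key : (∀ o, OrbitPoset.mk M (t o) ≤ o.1) ∨ ∀ o, o.1 ≤ OrbitPoset.mk M (t o) := by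
    refine hcomp.imp (fun h o => ?_) (fun h o => ?_)
    · calc _ ≤ OrbitPoset.mk M (r o) := OrbitPoset.mk_mono (h _ _ (hrt o))
        _ = _ := (hr o).2
    · calc _ = OrbitPoset.mk M (r o) := (hr o).2.symm
        _ ≤ _ := OrbitPoset.mk_mono (h _ _ (hrt o))
  exact contractibleSpace_of_comparable f i key (key.imp (fun h b => h (i b)) fun h b => h (i b)) hT

theorem HasContractibleOrbits.of_least {S : Set Y} (c : Y) (hc : c ∈ S)
    (h : ∀ d ∈ S, OrbitPoset.mk M c ≤ OrbitPoset.mk M d) : HasContractibleOrbits M S :=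
  contractibleSpace_of_least ⟨OrbitPoset.mk M c, c, hc, rfl⟩ (by
    rintro ⟨_, d, hd, rfl⟩
    exact h d hd)

end OrbitRetractions

/-! ### Inserting and deleting members of chains -/

theorem smul_mem_smul_chain {M X : Type*} [Group M] [PartialOrder X] [MulAction M X]
    [CovariantClass M X (· • ·) (· ≤ ·)] (g : M) (c : NonemptyFiniteChains X) (x : X) :
    g • x ∈ (g • c).finset ↔ x ∈ c.finset := by
  rw [mem_smul_chain]
  exact ⟨fun ⟨y, hy, h⟩ => smul_left_cancel g h ▸ hy, fun h => ⟨x, h, rfl⟩⟩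

section ChainRetractions

variable {M X : Type*} [Group M] [Finite M] [PartialOrder X] [MulAction M X]
  [CovariantClass M X (· • ·) (· ≤ ·)]

theorem exists_insert_chain (c : NonemptyFiniteChains X) (x : X)
    (h : ∀ y ∈ c.finset, y ≤ x ∨ x ≤ y) :
    ∃ d : NonemptyFiniteChains X, ∀ y, y ∈ d.finset ↔ y = x ∨ y ∈ c.finset := by
  classical
  refine ⟨⟨insert x c.finset, by simp, ?_⟩, fun y => by simp⟩
  rintro ⟨a, ha⟩ ⟨b, hb⟩
  rw [Subtype.mk_le_mk, Subtype.mk_le_mk]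
  rcases Finset.mem_insert.1 ha with rfl | ha' <;> rcases Finset.mem_insert.1 hb with rfl | hb'
  · exact Or.inl le_rfl
  · exact (h b hb').symm
  · exact h a ha'
  · exact c.comparable ⟨a, ha'⟩ ⟨b, hb'⟩

theorem exists_filter_chain (c : NonemptyFiniteChains X) (K : Set X)
    (h : ∃ y ∈ c.finset, y ∈ K) :
    ∃ d : NonemptyFiniteChains X, ∀ y, y ∈ d.finset ↔ y ∈ c.finset ∧ y ∈ K := by
  classical
  obtain ⟨y, hy, hyK⟩ := h
  refine ⟨⟨c.finset.filter (· ∈ K), ⟨y, by simp [hy, hyK]⟩, ?_⟩, fun y => by simp⟩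
  rintro ⟨a, ha⟩ ⟨b, hb⟩
  exact c.comparable ⟨a, (Finset.mem_filter.1 ha).1⟩ ⟨b, (Finset.mem_filter.1 hb).1⟩

/-- The chains with a member in `B` may be enlarged by an element of `N`, provided that this
element exists and is unique up to the elements of `M` that fix every member of the chain. -/
theorem HasContractibleOrbits.of_insert {S T : Set (NonemptyFiniteChains X)} (hTS : T ⊆ S)
    (B N : Set X) (hB : ∀ (g : M), ∀ x ∈ B, g • x ∈ B) (hN : ∀ (g : M), ∀ x ∈ N, g • x ∈ N)
    (hex : ∀ c ∈ S, (∃ y ∈ c.finset, y ∈ B) → ∃ x ∈ N, ∀ y ∈ c.finset, y ≤ x ∨ x ≤ y)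
    (huniq : ∀ c ∈ S, (∃ y ∈ c.finset, y ∈ B) → ∀ x ∈ N, ∀ x' ∈ N,
      (∀ y ∈ c.finset, y ≤ x ∨ x ≤ y) → (∀ y ∈ c.finset, y ≤ x' ∨ x' ≤ y) →
        ∃ g : M, (∀ y ∈ c.finset, g • y = y) ∧ g • x' = x)
    (hT₀ : ∀ c ∈ S, (∀ y ∈ c.finset, y ∉ B) → c ∈ T)
    (hT₁ : ∀ c ∈ S, (∃ y ∈ c.finset, y ∈ B) → ∀ x ∈ N, ∀ d : NonemptyFiniteChains X,
      (∀ y, y ∈ d.finset ↔ y = x ∨ y ∈ c.finset) → d ∈ T)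
    (hT : HasContractibleOrbits M T) : HasContractibleOrbits M S := by
  have hB' : ∀ (g : M) (c : NonemptyFiniteChains X),
      (∃ y ∈ (g • c).finset, y ∈ B) ↔ ∃ y ∈ c.finset, y ∈ B := by
    intro g c
    constructor
    · rintro ⟨y, hy, hyB⟩
      obtain ⟨z, hz, rfl⟩ := (mem_smul_chain g c y).1 hy
      exact ⟨z, hz, by simpa using hB g⁻¹ _ hyB⟩
    · rintro ⟨y, hy, hyB⟩
      exact ⟨g • y, (smul_mem_smul_chain g c y).2 hy, hB g y hyB⟩
  refine HasContractibleOrbits.of_relation hTS (fun c d =>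
    ((∃ y ∈ c.finset, y ∈ B) → ∃ x ∈ N, ∀ y, y ∈ d.finset ↔ y = x ∨ y ∈ c.finset) ∧
      ((¬ ∃ y ∈ c.finset, y ∈ B) → d = c)) ?_ ?_ ?_ (Or.inr ?_) hT
  · rintro g c d ⟨h₁, h₂⟩
    refine ⟨fun h => ?_, fun h => ?_⟩
    · obtain ⟨x, hx, hd⟩ := h₁ ((hB' g c).1 h)
      refine ⟨g • x, hN g x hx, fun y => ?_⟩
      have := hd (g⁻¹ • y)
      rw [← smul_mem_smul_chain g, ← smul_mem_smul_chain g c, smul_inv_smul,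
        inv_smul_eq_iff] at this
      exact this
    · rw [h₂ (fun h' => h ((hB' g c).2 h'))]
  · intro c hc
    by_cases h : ∃ y ∈ c.finset, y ∈ B
    · obtain ⟨x, hx, hcx⟩ := hex c hc h
      obtain ⟨d, hd⟩ := exists_insert_chain c x hcx
      exact ⟨d, hT₁ c hc h x hx d hd, fun _ => ⟨x, hx, hd⟩, fun h' => absurd h h'⟩
    · refine ⟨c, hT₀ c hc fun y hy hyB => h ⟨y, hy, hyB⟩, fun h' => absurd h' h, fun _ => rfl⟩
  · rintro c hc c' d d' hcc ⟨h₁, h₂⟩ ⟨h₁', h₂'⟩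
    by_cases h : ∃ y ∈ c.finset, y ∈ B
    · obtain ⟨y, hy, hyB⟩ := id h
      obtain ⟨x, hx, hd⟩ := h₁ h
      obtain ⟨x', hx', hd'⟩ := h₁' ⟨y, hcc hy, hyB⟩
      have hcd : ∀ (c₀ d₀ : NonemptyFiniteChains X) (x₀ : X), c ≤ c₀ →
          (∀ y, y ∈ d₀.finset ↔ y = x₀ ∨ y ∈ c₀.finset) → ∀ y ∈ c.finset, y ≤ x₀ ∨ x₀ ≤ y :=
        fun c₀ d₀ x₀ hle hd₀ y hy =>
          d₀.comparable ⟨y, (hd₀ y).2 (Or.inr (hle hy))⟩ ⟨x₀, (hd₀ x₀).2 (Or.inl rfl)⟩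
      obtain ⟨g, hg, hgx⟩ := huniq c hc h x hx x' hx' (hcd c d x le_rfl hd) (hcd c' d' x' hcc hd')
      rw [← OrbitPoset.mk_smul g d']
      refine OrbitPoset.mk_mono fun y hy => ?_
      rcases (hd y).1 hy with rfl | hy
      · rw [← hgx, smul_mem_smul_chain]
        exact (hd' x').2 (Or.inl rfl)
      · rw [← hg y hy, smul_mem_smul_chain]
        exact (hd' y).2 (Or.inr (hcc hy))
    · rw [h₂ h]
      refine OrbitPoset.mk_mono (hcc.trans ?_)
      by_cases h' : ∃ y ∈ c'.finset, y ∈ B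
      · obtain ⟨x', -, hd'⟩ := h₁' h'
        exact fun y hy => (hd' y).2 (Or.inr hy)
      · rw [h₂' h']
  · rintro c d ⟨h₁, h₂⟩
    by_cases h : ∃ y ∈ c.finset, y ∈ B
    · obtain ⟨x, -, hd⟩ := h₁ h
      exact fun y hy => (hd y).2 (Or.inr hy)
    · rw [h₂ h]

/-- If every chain of `S` has a member in `K`, then the members outside `K` may be deleted. -/
theorem HasContractibleOrbits.of_filter {S T : Set (NonemptyFiniteChains X)} (hTS : T ⊆ S)
    (K : Set X) (hK : ∀ (g : M), ∀ x ∈ K, g • x ∈ K)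
    (hex : ∀ c ∈ S, ∃ y ∈ c.finset, y ∈ K)
    (hST : ∀ c ∈ S, ∀ d : NonemptyFiniteChains X,
      (∀ y, y ∈ d.finset ↔ y ∈ c.finset ∧ y ∈ K) → d ∈ T)
    (hT : HasContractibleOrbits M T) : HasContractibleOrbits M S := by
  refine HasContractibleOrbits.of_relation hTS (fun c d =>
    ∀ y, y ∈ d.finset ↔ y ∈ c.finset ∧ y ∈ K) ?_ ?_ ?_ (Or.inl ?_) hT
  · intro g c d hd y
    have hKy : g⁻¹ • y ∈ K ↔ y ∈ K := ⟨fun h => by simpa using hK g _ h, hK g⁻¹ y⟩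
    have := hd (g⁻¹ • y)
    rwa [← smul_mem_smul_chain g, ← smul_mem_smul_chain g c, smul_inv_smul, hKy] at this
  · intro c hc
    obtain ⟨d, hd⟩ := exists_filter_chain c K (hex c hc)
    exact ⟨d, hST c hc d hd, hd⟩
  · intro c _ c' d d' hcc hd hd'
    refine OrbitPoset.mk_mono fun y hy => ?_
    have := (hd y).1 hy
    exact (hd' y).2 ⟨hcc this.1, this.2⟩
  · exact fun c d hd y hy => ((hd y).1 hy).1

end ChainRetractions

/-! ### Finite `p`-subgroups and conjugation -/

section Groups

variable {G : Type*} [Group G] {p : ℕ}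

theorem mem_conjAct_smul {A : Subgroup G} {g x : G} :
    x ∈ ConjAct.toConjAct g • A ↔ g⁻¹ * x * g ∈ A := by
  rw [Subgroup.mem_pointwise_smul_iff_inv_smul_mem, ← map_inv, ConjAct.toConjAct_smul, inv_inv]

theorem conj_smul_eq_of_mem_normalizer {A : Subgroup G} {h : G}
    (hh : h ∈ Subgroup.normalizer (A : Set G)) : ConjAct.toConjAct h • A = A := by
  ext x
  rw [mem_conjAct_smul, ← Subgroup.mem_normalizer_iff''.1 hh x]

theorem mem_normalizer_of_mem_centralizer {C A : Subgroup G} {h : G} (hA : A ≤ C)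
    (hh : h ∈ Subgroup.centralizer (C : Set G)) : h ∈ Subgroup.normalizer (A : Set G) := by
  rw [Subgroup.mem_normalizer_iff'']
  intro x
  have key : ∀ y ∈ A, h⁻¹ * y * h = y := fun y hy => by
    rw [mul_assoc, Subgroup.mem_centralizer_iff.1 hh y (hA hy), inv_mul_cancel_left]
  refine ⟨fun hx => by rwa [key x hx], fun hx => ?_⟩
  have h₁ := Subgroup.mem_centralizer_iff.1 hh _ (hA hx)
  have h₂ : h⁻¹ * x * h = x := mul_right_cancel (h₁.trans (by group))
  rwa [h₂] at hx

theorem conj_smul_eq_of_mem_centralizer {C A : Subgroup G} {h : G} (hA : A ≤ C)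
    (hh : h ∈ Subgroup.centralizer (C : Set G)) : ConjAct.toConjAct h • A = A :=
  conj_smul_eq_of_mem_normalizer (mem_normalizer_of_mem_centralizer hA hh)

theorem card_conjAct_smul (g : ConjAct G) (A : Subgroup G) :
    Nat.card (g • A : Subgroup G) = Nat.card A :=
  (Nat.card_congr (Subgroup.equivSMul g A).toEquiv).symm

theorem card_le_card_of_le [Finite G] {H K : Subgroup G} (h : H ≤ K) :
    Nat.card H ≤ Nat.card K :=
  Subgroup.card_le_of_le h

theorem card_mul_relIndex {H K : Subgroup G} (h : H ≤ K) :
    Nat.card H * H.relIndex K = Nat.card K := by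
  simpa only [Subgroup.relIndex_bot_left] using Subgroup.relIndex_mul_relIndex ⊥ H K bot_le h

theorem _root_.IsPGroup.prime_mul_card_le [Finite G] [hp : Fact p.Prime] {H K : Subgroup G}
    (hK : IsPGroup p K) (h : H < K) : p * Nat.card H ≤ Nat.card K := by
  have hmul := card_mul_relIndex h.le
  obtain ⟨n, hn⟩ := IsPGroup.iff_card.1 hK
  have hdvd : H.relIndex K ∣ p ^ n := hn ▸ hmul ▸ dvd_mul_left _ _
  obtain ⟨k, -, hk⟩ := (Nat.dvd_prime_pow hp.out).1 hdvd
  have hk0 : k ≠ 0 := by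
    rintro rfl
    rw [pow_zero, Subgroup.relIndex_eq_one] at hk
    exact h.not_ge hk
  have hle : p ≤ H.relIndex K := hk ▸ Nat.le_self_pow hk0 p
  calc p * Nat.card H = Nat.card H * p := mul_comm _ _
    _ ≤ Nat.card H * H.relIndex K := Nat.mul_le_mul_left _ hle
    _ = Nat.card K := hmul

/-- Normalizers grow in finite `p`-groups. -/
theorem _root_.IsPGroup.exists_mem_normalizer [Finite G] [Fact p.Prime] {H K : Subgroup G}
    (hK : IsPGroup p K) (h : H < K) :
    ∃ x ∈ K, x ∉ H ∧ x ∈ Subgroup.normalizer (H : Set G) := by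
  have := hK.isNilpotent
  have hlt : H.subgroupOf K < ⊤ := by
    rw [lt_top_iff_ne_top, Ne, Subgroup.subgroupOf_eq_top]
    exact h.not_ge
  obtain ⟨x, hxN, hxH⟩ := SetLike.exists_of_lt
    (Group.normalizerCondition_of_isNilpotent _ hlt)
  refine ⟨x, x.2, hxH, ?_⟩
  rw [Subgroup.mem_normalizer_iff] at hxN ⊢
  intro y
  have hconj : x.1 * y * x.1⁻¹ ∈ K → y ∈ K := fun hy => by
    have := K.mul_mem (K.mul_mem (K.inv_mem x.2) hy) x.2
    simpa [mul_assoc] using this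
  constructor
  · intro hy
    exact (hxN ⟨y, h.le hy⟩).1 hy
  · intro hy
    exact (hxN ⟨y, hconj (h.le hy)⟩).2 hy

/-- Sylow's theorem inside `H`: up to conjugation by `H`, any two `p`-subgroups of `H` lie in a
common `p`-subgroup of `H`. -/
theorem exists_common_isPGroup [Finite G] [Fact p.Prime] {H K₁ K₂ : Subgroup G} (h₁ : K₁ ≤ H)
    (h₂ : K₂ ≤ H) (hK₁ : IsPGroup p K₁) (hK₂ : IsPGroup p K₂) :
    ∃ h ∈ H, ∃ S ≤ H, IsPGroup p S ∧ K₁ ≤ S ∧ ConjAct.toConjAct h • K₂ ≤ S := by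
  obtain ⟨S₁, hS₁⟩ := (hK₁.comap_subtype (K := H)).exists_le_sylow
  obtain ⟨S₂, hS₂⟩ := (hK₂.comap_subtype (K := H)).exists_le_sylow
  obtain ⟨h, rfl⟩ := MulAction.exists_smul_eq H S₂ S₁
  refine ⟨h, h.2, (h • S₂ : Sylow p H).1.map H.subtype, Subgroup.map_subtype_le _,
    (h • S₂).2.map _, ?_, ?_⟩
  · intro x hx
    exact ⟨⟨x, h₁ hx⟩, hS₁ hx, rfl⟩
  · intro x hx
    rw [mem_conjAct_smul] at hx
    refine ⟨h * ⟨_, h₂ hx⟩ * h⁻¹, ?_, by simp [mul_assoc]⟩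
    exact Subgroup.smul_mem_pointwise_smul _ (MulAut.conj h) _ (hS₂ hx)

/-- A `p`-subgroup of `H` is contained in an `H`-conjugate of any Sylow subgroup of `G` that lies
in `H`. -/
theorem exists_le_smul_sylow [Finite G] [Fact p.Prime] {H K : Subgroup G} (Q : Sylow p G)
    (hQ : (Q : Subgroup G) ≤ H) (hKH : K ≤ H) (hK : IsPGroup p K) :
    ∃ h ∈ H, K ≤ ConjAct.toConjAct h • (Q : Subgroup G) := by
  obtain ⟨h, hh, S, -, hS, hQS, hKS⟩ := exists_common_isPGroup hQ hKH Q.2 hK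
  rw [Q.is_maximal' hS hQS] at hKS
  refine ⟨h⁻¹, H.inv_mem hh, ?_⟩
  rw [map_inv, ← Subgroup.pointwise_smul_le_pointwise_smul_iff (a := ConjAct.toConjAct h),
    smul_inv_smul]
  exact hKS

end Groups

/-! ### Elementary abelian subgroups -/

section ElementaryAbelian

variable {G : Type*} [Group G] {p : ℕ}

theorem IsElementaryAbelian.isPGroup {A : Subgroup G} (hA : IsElementaryAbelian p A) :
    IsPGroup p A := fun x => ⟨1, Subtype.ext (by simpa using hA.pow_eq_one x x.2)⟩

theorem IsElementaryAbelian.le_centralizer {A B : Subgroup G} (hA : IsElementaryAbelian p A)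
    (h : B ≤ A) : A ≤ Subgroup.centralizer (B : Set G) := fun x hx =>
  Subgroup.mem_centralizer_iff.2 fun y hy => hA.comm y (h hy) x hx

theorem IsElementaryAbelian.mono {A B : Subgroup G} (hA : IsElementaryAbelian p A) (h : B ≤ A) :
    IsElementaryAbelian p B where
  comm x hx y hy := hA.comm x (h hx) y (h hy)
  pow_eq_one x hx := hA.pow_eq_one x (h hx)

theorem IsElementaryAbelian.sup {A B : Subgroup G} (hA : IsElementaryAbelian p A)
    (hB : IsElementaryAbelian p B) (h : A ≤ Subgroup.centralizer (B : Set G)) :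
    IsElementaryAbelian p (A ⊔ B : Subgroup G) := by
  have hA' : A ⊔ B ≤ Subgroup.centralizer (A : Set G) :=
    sup_le (hA.le_centralizer le_rfl) (Subgroup.le_centralizer_iff.1 h)
  have hB' : A ⊔ B ≤ Subgroup.centralizer (B : Set G) :=
    sup_le h (hB.le_centralizer le_rfl)
  have hAB : A ⊔ B ≤ Subgroup.centralizer ((A ⊔ B : Subgroup G) : Set G) :=
    sup_le (Subgroup.le_centralizer_iff.1 hA') (Subgroup.le_centralizer_iff.1 hB')
  have hcomm : ∀ x ∈ A ⊔ B, ∀ y ∈ A ⊔ B, x * y = y * x := fun x hx y hy =>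
    Subgroup.mem_centralizer_iff.1 (hAB hy) x hx
  refine ⟨hcomm, fun x hx => ?_⟩
  rw [Subgroup.sup_eq_closure] at hcomm hx
  induction hx using Subgroup.closure_induction with
  | mem x hx => exact hx.elim (hA.pow_eq_one x) (hB.pow_eq_one x)
  | one => exact one_pow p
  | mul x y hx hy ihx ihy =>
    rw [(show Commute x y from hcomm x hx y hy).mul_pow, ihx, ihy, one_mul]
  | inv x _ ih => rw [inv_pow, ih, inv_one]

/-- `Ω₁(Z(H))`: the central elements of `H` of order dividing `p`. -/
def omegaCenter (p : ℕ) (H : Subgroup G) : Subgroup G where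
  carrier := {x | x ∈ H ∧ x ∈ Subgroup.centralizer (H : Set G) ∧ x ^ p = 1}
  one_mem' := ⟨H.one_mem, Subgroup.one_mem _, one_pow p⟩
  mul_mem' := by
    rintro x y ⟨hx, hx', hxp⟩ ⟨hy, hy', hyp⟩
    have hxy : Commute x y := (Subgroup.mem_centralizer_iff.1 hx' y hy).symm
    exact ⟨H.mul_mem hx hy, Subgroup.mul_mem _ hx' hy', by rw [hxy.mul_pow, hxp, hyp, one_mul]⟩
  inv_mem' := by
    rintro x ⟨hx, hx', hxp⟩
    exact ⟨H.inv_mem hx, Subgroup.inv_mem _ hx', by rw [inv_pow, hxp, inv_one]⟩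

theorem omegaCenter_le (H : Subgroup G) : omegaCenter p H ≤ H := fun _ hx => hx.1

theorem le_centralizer_omegaCenter (H : Subgroup G) :
    H ≤ Subgroup.centralizer (omegaCenter p H : Set G) :=
  Subgroup.le_centralizer_iff.1 fun _ hx => hx.2.1

theorem isElementaryAbelian_omegaCenter (H : Subgroup G) :
    IsElementaryAbelian p (omegaCenter p H) where
  comm _ hx _ hy := Subgroup.mem_centralizer_iff.1 hy.2.1 _ hx.1
  pow_eq_one _ hx := hx.2.2

theorem IsElementaryAbelian.omegaCenter_eq {A : Subgroup G} (hA : IsElementaryAbelian p A) :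
    omegaCenter p A = A :=
  le_antisymm (omegaCenter_le A) fun x hx => ⟨hx, hA.le_centralizer le_rfl hx, hA.pow_eq_one x hx⟩

theorem IsElementaryAbelian.le_omegaCenter {A H : Subgroup G} (hA : IsElementaryAbelian p A)
    (hAH : A ≤ H) (h : H ≤ Subgroup.centralizer (A : Set G)) : A ≤ omegaCenter p H :=
  fun x hx => ⟨hAH hx, Subgroup.le_centralizer_iff.1 h hx, hA.pow_eq_one x hx⟩

theorem IsElementaryAbelian.sup_omegaCenter {A H : Subgroup G} (hA : IsElementaryAbelian p A)
    (h : A ≤ H) : IsElementaryAbelian p (A ⊔ omegaCenter p H : Subgroup G) :=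
  hA.sup (isElementaryAbelian_omegaCenter H) (h.trans (le_centralizer_omegaCenter H))

theorem smul_omegaCenter (g : ConjAct G) (H : Subgroup G) :
    g • omegaCenter p H = omegaCenter p (g • H) := by
  have key : ∀ (g : ConjAct G) (H : Subgroup G), g • omegaCenter p H ≤ omegaCenter p (g • H) := by
    intro g H
    refine ((isElementaryAbelian_omegaCenter H).smul g).le_omegaCenter
      (Subgroup.pointwise_smul_le_pointwise_smul_iff.2 (omegaCenter_le H)) ?_
    intro x hx
    rw [Subgroup.mem_pointwise_smul_iff_inv_smul_mem] at hx
    refine Subgroup.mem_centralizer_iff.2 fun y hy => ?_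
    rw [SetLike.mem_coe, Subgroup.mem_pointwise_smul_iff_inv_smul_mem] at hy
    refine MulAction.injective g⁻¹ (?_ : g⁻¹ • (y * x) = g⁻¹ • (x * y))
    rw [smul_mul', smul_mul']
    exact Subgroup.mem_centralizer_iff.1 (le_centralizer_omegaCenter H hx) _ hy
  refine le_antisymm (key g H) ?_
  have := key g⁻¹ (g • H)
  rw [inv_smul_smul] at this
  rwa [← Subgroup.pointwise_smul_le_pointwise_smul_iff (a := g⁻¹), inv_smul_smul]

theorem card_omegaCenter_eq [Finite G] [Fact p.Prime] (Q Q' : Sylow p G) :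
    Nat.card (omegaCenter p (Q : Subgroup G)) = Nat.card (omegaCenter p (Q' : Subgroup G)) := by
  obtain ⟨h, -, hh⟩ := exists_le_smul_sylow (H := ⊤) Q le_top le_top Q'.2
  have heq : ConjAct.toConjAct h • (Q : Subgroup G) = Q' :=
    Q'.is_maximal' (ConjAct.toConjAct h • Q : Sylow p G).2 hh
  rw [← card_conjAct_smul (ConjAct.toConjAct h) (omegaCenter p (Q : Subgroup G)),
    smul_omegaCenter, heq]

theorem omegaCenter_ne_bot [Finite G] [hp : Fact p.Prime] {H : Subgroup G} (hH : IsPGroup p H)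
    (hne : H ≠ ⊥) : omegaCenter p H ≠ ⊥ := by
  have : Nontrivial H := (Subgroup.nontrivial_iff_ne_bot H).2 hne
  have := hH.center_nontrivial
  obtain ⟨n, hn0, hn⟩ := IsPGroup.nontrivial_iff_card (hH.to_subgroup (Subgroup.center H)) |>.1 this
  obtain ⟨x, hx⟩ := exists_prime_orderOf_dvd_card' (G := Subgroup.center H) p
    (hn ▸ dvd_pow_self p hn0.ne')
  intro hbot
  have hxp : x ^ p = 1 := hx ▸ pow_orderOf_eq_one x
  have hmem : (x : G) ∈ omegaCenter p H := by
    refine ⟨x.1.2, Subgroup.mem_centralizer_iff.2 fun y hy => ?_, ?_⟩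
    · exact congrArg Subtype.val (Subgroup.mem_center_iff.1 x.2 ⟨y, hy⟩)
    · simpa using congrArg (fun t : Subgroup.center H => ((t : H) : G)) hxp
  rw [hbot, Subgroup.mem_bot] at hmem
  have h1 : x = 1 := Subtype.ext (Subtype.ext hmem)
  rw [h1, orderOf_one] at hx
  exact hp.out.one_lt.ne hx

end ElementaryAbelian

/-! ### Centers of Sylow subgroups inside an elementary abelian subgroup -/

section OmegaCenters

variable {G : Type*} [Group G] [Finite G] {p : ℕ} [Fact p.Prime] {z : ℕ} {E : Subgroup G}

theorem exists_sylow_le_of_omegaCenter_le (hE : IsElementaryAbelian p E) (Q : Sylow p G)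
    (h : omegaCenter p (Q : Subgroup G) ≤ E) : ∃ Q' : Sylow p G, E ≤ Q' ∧
      omegaCenter p (Q' : Subgroup G) = omegaCenter p (Q : Subgroup G) := by
  obtain ⟨g, hg, hEg⟩ := exists_le_smul_sylow Q (le_centralizer_omegaCenter (p := p) _)
    (hE.le_centralizer h) hE.isPGroup
  refine ⟨ConjAct.toConjAct g • Q, hEg, ?_⟩
  change omegaCenter p (ConjAct.toConjAct g • (Q : Subgroup G)) = _
  rw [← smul_omegaCenter, conj_smul_eq_of_mem_centralizer le_rfl hg]

/-- When `Ω₁(Z(Q))` has index `p` in `E` and `N_Q(E)` acts nontrivially on `E`, the fixed points of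
this action are exactly `Ω₁(Z(Q))`. -/
theorem inf_centralizer_eq_omegaCenter (hE : IsElementaryAbelian p E) (Q : Sylow p G)
    (hcard : Nat.card E = p * Nat.card (omegaCenter p (Q : Subgroup G)))
    (hQ : omegaCenter p (Q : Subgroup G) ≤ E)
    (hne : ¬ (Q : Subgroup G) ⊓ Subgroup.normalizer (E : Set G) ≤
      Subgroup.centralizer (E : Set G)) :
    E ⊓ Subgroup.centralizer (((Q : Subgroup G) ⊓ Subgroup.normalizer (E : Set G) : Subgroup G) :
      Set G) = omegaCenter p (Q : Subgroup G) := by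
  set F := E ⊓ Subgroup.centralizer
    (((Q : Subgroup G) ⊓ Subgroup.normalizer (E : Set G) : Subgroup G) : Set G)
  have hle : omegaCenter p (Q : Subgroup G) ≤ F :=
    le_inf hQ (Subgroup.le_centralizer_iff.1
      (inf_le_left.trans (le_centralizer_omegaCenter _)))
  by_contra hF
  have hlt := lt_of_le_of_ne hle (Ne.symm hF)
  have hcardF := (hE.mono (inf_le_left : F ≤ E)).isPGroup.prime_mul_card_le hlt
  rw [← hcard] at hcardF
  have hFE : F = E := Subgroup.eq_of_le_of_card_ge inf_le_left hcardF
  exact hne (Subgroup.le_centralizer_iff.1 (hFE.ge.trans inf_le_right))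

/-- Inside an elementary abelian subgroup `E`, the subgroups of index `p` of the form `Ω₁(Z(Q))`
are fixed-point subgroups of Sylow subgroups of `C_G(C) ∩ N_G(E)`, hence conjugate in that group. -/
theorem exists_conj_omegaCenter_eq (hz : ∀ Q : Sylow p G,
      Nat.card (omegaCenter p (Q : Subgroup G)) = z)
    (hE : IsElementaryAbelian p E) (hcard : Nat.card E = p * z)
    (hmem : ∀ Q : Sylow p G, E ≤ Q → omegaCenter p (Q : Subgroup G) ≤ E)
    (hne : ∀ Q : Sylow p G, E ≤ Q → ¬ (Q : Subgroup G) ⊓ Subgroup.normalizer (E : Set G) ≤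
      Subgroup.centralizer (E : Set G))
    {C : Subgroup G} (Q₁ Q₂ : Sylow p G)
    (hC₁ : C ≤ omegaCenter p (Q₁ : Subgroup G)) (hC₂ : C ≤ omegaCenter p (Q₂ : Subgroup G))
    (h₁ : omegaCenter p (Q₁ : Subgroup G) ≤ E) (h₂ : omegaCenter p (Q₂ : Subgroup G) ≤ E) :
    ∃ h ∈ Subgroup.centralizer (C : Set G), h ∈ Subgroup.normalizer (E : Set G) ∧
      ConjAct.toConjAct h • omegaCenter p (Q₂ : Subgroup G) = omegaCenter p (Q₁ : Subgroup G) := by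
  obtain ⟨R₁, hER₁, hR₁⟩ := exists_sylow_le_of_omegaCenter_le hE Q₁ h₁
  obtain ⟨R₂, hER₂, hR₂⟩ := exists_sylow_le_of_omegaCenter_le hE Q₂ h₂
  rw [← hR₁] at hC₁ ⊢
  rw [← hR₂] at hC₂ ⊢
  have hcent : ∀ R : Sylow p G, C ≤ omegaCenter p (R : Subgroup G) →
      (R : Subgroup G) ≤ Subgroup.centralizer (C : Set G) := fun R hR =>
    (le_centralizer_omegaCenter _).trans (Subgroup.centralizer_le hR)
  obtain ⟨h, hh, S, hSH, hS, hS₁, hS₂⟩ := exists_common_isPGroup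
    (inf_le_inf_right (Subgroup.normalizer (E : Set G)) (hcent R₁ hC₁))
    (inf_le_inf_right (Subgroup.normalizer (E : Set G)) (hcent R₂ hC₂))
    (R₁.2.to_le inf_le_left) (R₂.2.to_le inf_le_left)
  refine ⟨h, hh.1, hh.2, ?_⟩
  obtain ⟨R, hSR⟩ := hS.exists_le_sylow
  have hES : E ≤ S := (le_inf hER₁ Subgroup.le_normalizer).trans hS₁
  -- Any Sylow subgroup containing `E` whose normalizer part lies in `S` has the same center as `R`.
  have key : ∀ T : Sylow p G, E ≤ T →
      (T : Subgroup G) ⊓ Subgroup.normalizer (E : Set G) ≤ S →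
      omegaCenter p (R : Subgroup G) = omegaCenter p (T : Subgroup G) := by
    intro T hET hT
    refine Subgroup.eq_of_le_of_card_ge ?_ (by rw [hz, hz])
    rw [← inf_centralizer_eq_omegaCenter hE T (by rw [hz, hcard]) (hmem T hET) (hne T hET)]
    exact le_inf (hmem R (hES.trans hSR)) (Subgroup.le_centralizer_iff.1
      ((hT.trans hSR).trans (le_centralizer_omegaCenter _)))
  have hEh := conj_smul_eq_of_mem_normalizer hh.2
  rw [smul_omegaCenter, ← key R₁ hER₁ hS₁]
  refine (key (ConjAct.toConjAct h • R₂) ?_ ?_).symm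
  · change E ≤ ConjAct.toConjAct h • (R₂ : Subgroup G)
    rw [← hEh]
    exact Subgroup.pointwise_smul_le_pointwise_smul_iff.2 hER₂
  · rintro y ⟨hy, hyN⟩
    refine hS₂ (mem_conjAct_smul.2 ⟨mem_conjAct_smul.1 hy, ?_⟩)
    exact Subgroup.mul_mem _ (Subgroup.mul_mem _ (Subgroup.inv_mem _ hh.2) hyN) hh.2

end OmegaCenters

/-! ### Contractibility from a controlling family -/

section ControllingFamily

variable {G : Type*} [Group G] {p : ℕ}

/-- A conjugation-invariant family `𝓜` of elementary abelian subgroups that controls the orbit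
space of chains. Besides the fusion property `exists_conj`, the conditions concern the elementary
abelian subgroups `E` that lie in no member of `𝓜`: their order is at most `p * z`, where `z` is the
order of the groups `Ω₁(Z(Q))`, `Q` Sylow, and if equality holds, then every subgroup of `E` that
lies in a member of `𝓜` lies in some `Ω₁(Z(Q)) ≤ E`, and `N_Q(E)` acts nontrivially on `E`. -/
structure IsControllingFamily (p z : ℕ) (𝓜 : Set (Subgroup G)) : Prop where
  isElementaryAbelian : ∀ x ∈ 𝓜, IsElementaryAbelian p x
  smul_mem : ∀ (g : ConjAct G), ∀ x ∈ 𝓜, g • x ∈ 𝓜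
  card_omegaCenter : ∀ Q : Sylow p G, Nat.card (omegaCenter p (Q : Subgroup G)) = z
  omegaCenter_le : ∀ Q : Sylow p G, ∃ x ∈ 𝓜, omegaCenter p (Q : Subgroup G) ≤ x
  exists_conj : ∀ x ∈ 𝓜, ∀ x' ∈ 𝓜, ∀ C : Subgroup G, C ≤ x → C ≤ x' →
    ∃ h ∈ Subgroup.centralizer (C : Set G), ConjAct.toConjAct h • x' = x
  card_le : ∀ E : Subgroup G, IsElementaryAbelian p E → (∀ x ∈ 𝓜, ¬ E ≤ x) → Nat.card E ≤ p * z
  exists_omegaCenter : ∀ E : Subgroup G, IsElementaryAbelian p E → (∀ x ∈ 𝓜, ¬ E ≤ x) →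
    Nat.card E = p * z → ∀ C ≤ E, (∃ x ∈ 𝓜, C ≤ x) →
      ∃ Q : Sylow p G, C ≤ omegaCenter p (Q : Subgroup G) ∧ omegaCenter p (Q : Subgroup G) ≤ E
  not_le_centralizer : ∀ E : Subgroup G, IsElementaryAbelian p E → (∀ x ∈ 𝓜, ¬ E ≤ x) →
    Nat.card E = p * z → ∀ Q : Sylow p G, E ≤ Q →
      ¬ (Q : Subgroup G) ⊓ Subgroup.normalizer (E : Set G) ≤ Subgroup.centralizer (E : Set G)

variable {z : ℕ} {𝓜 : Set (Subgroup G)}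

namespace IsControllingFamily

theorem not_le_of_le {E F : Subgroup G} (h : E ≤ F) (hE : ∀ x ∈ 𝓜, ¬ E ≤ x) :
    ∀ x ∈ 𝓜, ¬ F ≤ x := fun x hx hF => hE x hx (h.trans hF)

variable [Finite G]

theorem eq_of_le (h𝓜 : IsControllingFamily p z 𝓜) {x x' : Subgroup G} (hx : x ∈ 𝓜)
    (hx' : x' ∈ 𝓜) (hle : x ≤ x') : x = x' := by
  obtain ⟨h, -, hh⟩ := h𝓜.exists_conj x hx x' hx' x le_rfl hle
  refine Subgroup.eq_of_le_of_card_ge hle ?_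
  rw [← hh, card_conjAct_smul]

theorem omegaCenter_le_of_le (h𝓜 : IsControllingFamily p z 𝓜) {E : Subgroup G}
    (hE : IsElementaryAbelian p E) (hout : ∀ x ∈ 𝓜, ¬ E ≤ x) (hcard : Nat.card E = p * z)
    (Q : Sylow p G) (hQ : E ≤ Q) : omegaCenter p (Q : Subgroup G) ≤ E := by
  have h₁ := h𝓜.card_le _ (hE.sup_omegaCenter hQ) (not_le_of_le le_sup_left hout)
  have h₂ : E = E ⊔ omegaCenter p (Q : Subgroup G) :=
    Subgroup.eq_of_le_of_card_ge le_sup_left (by rwa [hcard])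
  rw [h₂]
  exact le_sup_right

variable [Fact p.Prime]

theorem card_sup_omegaCenter (h𝓜 : IsControllingFamily p z 𝓜) {C : Subgroup G}
    (hC : IsElementaryAbelian p C) (hout : ∀ x ∈ 𝓜, ¬ C ≤ x) (Q : Sylow p G) (hQ : C ≤ Q) :
    Nat.card (C ⊔ omegaCenter p (Q : Subgroup G) : Subgroup G) = p * z := by
  have hel := hC.sup_omegaCenter hQ
  refine le_antisymm (h𝓜.card_le _ hel (not_le_of_le le_sup_left hout)) ?_
  obtain ⟨x, hx, hQx⟩ := h𝓜.omegaCenter_le Q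
  rw [← h𝓜.card_omegaCenter Q]
  refine hel.isPGroup.prime_mul_card_le (lt_of_le_not_ge le_sup_right fun hle => ?_)
  exact hout x hx ((le_sup_left.trans hle).trans hQx)

/-- Outside `𝓜`, the subgroups of order `p * z` above `C` are the groups `C * Ω₁(Z(Q))`, which are
conjugate in the centralizer of `C`. -/
theorem exists_conj_of_card (h𝓜 : IsControllingFamily p z 𝓜) {C x x' : Subgroup G}
    (hout : ∀ y ∈ 𝓜, ¬ C ≤ y) (hx : IsElementaryAbelian p x) (hx' : IsElementaryAbelian p x')
    (hcard : Nat.card x = p * z) (hcard' : Nat.card x' = p * z) (hCx : C ≤ x) (hCx' : C ≤ x') :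
    ∃ h ∈ Subgroup.centralizer (C : Set G), ConjAct.toConjAct h • x' = x := by
  obtain ⟨h, hh, S, -, hS, hxS, hxS'⟩ := exists_common_isPGroup
    (hx.le_centralizer hCx) (hx'.le_centralizer hCx') hx.isPGroup hx'.isPGroup
  obtain ⟨Q, hSQ⟩ := hS.exists_le_sylow
  have key : ∀ y : Subgroup G, IsElementaryAbelian p y → Nat.card y = p * z → C ≤ y → y ≤ S →
      C ⊔ omegaCenter p (Q : Subgroup G) = y := by
    intro y hy hyc hCy hyS
    refine Subgroup.eq_of_le_of_card_ge (sup_le hCy ?_) ?_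
    · exact h𝓜.omegaCenter_le_of_le hy (not_le_of_le hCy hout) hyc Q (hyS.trans hSQ)
    · rw [hyc, h𝓜.card_sup_omegaCenter (hy.mono hCy) hout Q ((hCy.trans hyS).trans hSQ)]
  refine ⟨h, hh, ?_⟩
  rw [← key x hx hcard hCx hxS]
  refine (key _ (hx'.smul _) (by rw [card_conjAct_smul, hcard']) ?_ hxS').symm
  rw [← conj_smul_eq_of_mem_centralizer le_rfl hh]
  exact Subgroup.pointwise_smul_le_pointwise_smul_iff.2 hCx'

end IsControllingFamily

theorem exists_max_mem_chain {X : Type*} [PartialOrder X] (c : NonemptyFiniteChains X) :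
    ∃ x ∈ c.finset, ∀ y ∈ c.finset, y ≤ x := by
  obtain ⟨x, hx⟩ := c.finset.exists_maximal c.nonempty
  exact ⟨x, hx.1, fun y hy => (c.comparable ⟨y, hy⟩ ⟨x, hx.1⟩).elim id fun h => hx.2 hy h⟩

end ControllingFamily

section ControllingFamily

variable {G : Type*} [Group G] {p : ℕ} {z : ℕ} {𝓜 : Set (Subgroup G)}

theorem conj_smul_eq_of_coe_le {C : Subgroup G} {h : G}
    (hh : h ∈ Subgroup.centralizer (C : Set G)) {y : ElementaryAbelianPoset p G}
    (hy : (y : Subgroup G) ≤ C) : ConjAct.toConjAct h • y = y :=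
  Subtype.ext (conj_smul_eq_of_mem_centralizer hy hh)

theorem eq_of_comparable [Finite G] {x y : ElementaryAbelianPoset p G} (h : x ≤ y ∨ y ≤ x)
    (hcard : Nat.card (x : Subgroup G) = Nat.card (y : Subgroup G)) : x = y :=
  Subtype.ext (h.elim (fun h => Subgroup.eq_of_le_of_card_ge h hcard.ge)
    fun h => (Subgroup.eq_of_le_of_card_ge h hcard.le).symm)

theorem le_of_comparable [Finite G] {x y : ElementaryAbelianPoset p G} (h : x ≤ y ∨ y ≤ x)
    (hcard : Nat.card (x : Subgroup G) ≤ Nat.card (y : Subgroup G)) : x ≤ y :=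
  h.elim id fun h => (Subtype.ext (Subgroup.eq_of_le_of_card_ge (H := (y : Subgroup G)) h hcard) :
    y = x).ge

/-- The elementary abelian subgroups contained in no member of `𝓜`. -/
def outside (p : ℕ) (𝓜 : Set (Subgroup G)) : Set (ElementaryAbelianPoset p G) :=
  {E | ∀ x ∈ 𝓜, ¬ (E : Subgroup G) ≤ x}

theorem not_mem_outside {E : ElementaryAbelianPoset p G} :
    E ∉ outside p 𝓜 ↔ ∃ x ∈ 𝓜, (E : Subgroup G) ≤ x := by
  simp [outside]

theorem outside_of_le {E F : ElementaryAbelianPoset p G} (h : E ≤ F) (hE : E ∈ outside p 𝓜) :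
    F ∈ outside p 𝓜 := IsControllingFamily.not_le_of_le h hE

namespace IsControllingFamily

variable (h𝓜 : IsControllingFamily p z 𝓜)

include h𝓜

theorem smul_mem_outside (g : ConjAct G) {E : ElementaryAbelianPoset p G}
    (hE : E ∈ outside p 𝓜) : g • E ∈ outside p 𝓜 := by
  intro x hx hle
  refine hE (g⁻¹ • x) (h𝓜.smul_mem _ x hx) ?_
  rw [← Subgroup.pointwise_smul_le_pointwise_smul_iff (a := g), smul_inv_smul]
  exact hle

/-- For a chain through a subgroup `E` outside `𝓜` of order `p * z`, there is a largest subgroup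
`C`, possibly trivial, among those members lying in a member of `𝓜`. -/
theorem exists_sup_of_not_outside {E : ElementaryAbelianPoset p G} (hE : E ∈ outside p 𝓜)
    (c : NonemptyFiniteChains (ElementaryAbelianPoset p G)) (hEc : E ∈ c.finset) :
    ∃ C : Subgroup G, C ≤ E ∧ (∃ x ∈ 𝓜, C ≤ x) ∧
      (C = ⊥ ∨ ∃ y ∈ c.finset, y ∉ outside p 𝓜 ∧ (y : Subgroup G) = C) ∧
      ∀ y ∈ c.finset, y ∉ outside p 𝓜 → (y : Subgroup G) ≤ C := by
  by_cases hin : ∃ y ∈ c.finset, y ∉ outside p 𝓜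
  · obtain ⟨d, hd⟩ := exists_filter_chain c (outside p 𝓜)ᶜ hin
    obtain ⟨C, hC, hCmax⟩ := exists_max_mem_chain d
    obtain ⟨hCc, hCout⟩ := (hd C).1 hC
    refine ⟨C, ?_, not_mem_outside.1 hCout, Or.inr ⟨C, hCc, hCout, rfl⟩,
      fun y hy hyout => hCmax y ((hd y).2 ⟨hy, hyout⟩)⟩
    exact (c.comparable ⟨C, hCc⟩ ⟨E, hEc⟩).elim id fun h => absurd (outside_of_le h hE) hCout
  · obtain ⟨Q⟩ := (inferInstance : Nonempty (Sylow p G))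
    obtain ⟨x, hx, -⟩ := h𝓜.omegaCenter_le Q
    exact ⟨⊥, bot_le, ⟨x, hx, bot_le⟩, Or.inl rfl, fun y hy hyout => absurd ⟨y, hy, hyout⟩ hin⟩

variable [Finite G]

/-- Among the chains contained in members of `𝓜`, adding a member of `𝓜` on top retracts the orbits
onto those above the single orbit `𝓜`. -/
theorem hasContractibleOrbits_of_not_outside
    (hne : ∀ x ∈ 𝓜, x ≠ ⊥) {x₀ : Subgroup G} (hx₀ : x₀ ∈ 𝓜) :
    HasContractibleOrbits (ConjAct G)
      {c : NonemptyFiniteChains (ElementaryAbelianPoset p G) |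
        ∀ y ∈ c.finset, y ∉ outside p 𝓜} := by
  have hmem : ∀ x ∈ 𝓜, ∀ c : NonemptyFiniteChains (ElementaryAbelianPoset p G),
      (∀ y ∈ c.finset, y ∉ outside p 𝓜) → ∀ y ∈ c.finset,
        ((y : Subgroup G) ≤ x ∨ x ≤ y) → (y : Subgroup G) ≤ x := by
    intro x hx c hc y hy hcomp
    refine hcomp.elim id fun hxy => ?_
    obtain ⟨x', hx', hyx'⟩ := not_mem_outside.1 (hc y hy)
    rw [h𝓜.eq_of_le hx hx' (hxy.trans hyx')]
    exact hyx'
  refine HasContractibleOrbits.of_insert (M := ConjAct G)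
    (T := {c | (∀ y ∈ c.finset, y ∉ outside p 𝓜) ∧ ∃ y ∈ c.finset, (y : Subgroup G) ∈ 𝓜})
    (fun c hc => hc.1) Set.univ {y | (y : Subgroup G) ∈ 𝓜} (fun _ _ _ => trivial)
    (fun g x hx => h𝓜.smul_mem g _ hx) ?_ ?_ ?_ ?_ ?_
  · intro c hc _
    obtain ⟨C, hC, hCmax⟩ := exists_max_mem_chain c
    obtain ⟨x, hx, hCx⟩ := not_mem_outside.1 (hc C hC)
    exact ⟨⟨x, hne x hx, h𝓜.isElementaryAbelian x hx⟩, hx, fun y hy =>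
      Or.inl ((hCmax y hy).trans hCx)⟩
  · intro c hc _ x hx x' hx' hcx hcx'
    obtain ⟨C, hC, hCmax⟩ := exists_max_mem_chain c
    obtain ⟨h, hh, hxx'⟩ := h𝓜.exists_conj x hx x' hx' C (hmem x hx c hc C hC (hcx C hC))
      (hmem x' hx' c hc C hC (hcx' C hC))
    exact ⟨ConjAct.toConjAct h, fun y hy => conj_smul_eq_of_coe_le hh (hCmax y hy),
      Subtype.ext hxx'⟩
  · intro c hc hB
    obtain ⟨y, hy⟩ := c.nonempty
    exact absurd trivial (hB y hy)
  · intro c hc _ x hx d hd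
    refine ⟨fun y hy => ?_, x, (hd x).2 (Or.inl rfl), hx⟩
    rcases (hd y).1 hy with rfl | hy
    · exact not_mem_outside.2 ⟨_, hx, le_rfl⟩
    · exact hc y hy
  · let X₀ : ElementaryAbelianPoset p G := ⟨x₀, hne x₀ hx₀, h𝓜.isElementaryAbelian x₀ hx₀⟩
    refine HasContractibleOrbits.of_least ⟨{X₀}, by simp, by
      rintro ⟨a, ha⟩ ⟨b, hb⟩
      rw [Finset.mem_singleton] at ha hb
      exact Or.inl (ha.trans hb.symm).le⟩ ⟨?_, X₀, by simp, hx₀⟩ ?_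
    · intro y hy
      rw [Finset.mem_singleton] at hy
      exact hy ▸ not_mem_outside.2 ⟨x₀, hx₀, le_rfl⟩
    · rintro d ⟨-, y, hy, hy𝓜⟩
      obtain ⟨h, -, hh⟩ := h𝓜.exists_conj x₀ hx₀ y hy𝓜 ⊥ bot_le bot_le
      rw [← OrbitPoset.mk_smul (ConjAct.toConjAct h) d]
      refine OrbitPoset.mk_mono fun w hw => ?_
      rw [Finset.mem_singleton] at hw
      have hw' : w = ConjAct.toConjAct h • y := hw.trans (Subtype.ext hh.symm)
      rw [hw', smul_mem_smul_chain]
      exact hy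

/-- Members of `𝒜_p(G)` comparable with a subgroup outside `𝓜` of order `p * z` lie below it. -/
theorem le_of_card {E y : ElementaryAbelianPoset p G}
    (hE : Nat.card (E : Subgroup G) = p * z) (hout : E ∈ outside p 𝓜) (h : y ≤ E ∨ E ≤ y) :
    y ≤ E :=
  h.elim id fun h => le_of_comparable (Or.inr h)
    ((h𝓜.card_le y y.2.2 (outside_of_le h hout)).trans hE.ge)

/-- A controlling family makes `𝒜_p(G)'/G` contractible. -/
theorem hasContractibleOrbits_univ [Fact p.Prime] (hz : z ≠ 1) (hne : ∀ x ∈ 𝓜, x ≠ ⊥) :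
    HasContractibleOrbits (ConjAct G)
      (Set.univ : Set (NonemptyFiniteChains (ElementaryAbelianPoset p G))) := by
  obtain ⟨Q₀⟩ := (inferInstance : Nonempty (Sylow p G))
  obtain ⟨x₀, hx₀, -⟩ := h𝓜.omegaCenter_le Q₀
  have hω : ∀ Q : Sylow p G, omegaCenter p (Q : Subgroup G) ≠ ⊥ := fun Q hQ => by
    have := h𝓜.card_omegaCenter Q
    rw [hQ, Subgroup.card_bot] at this
    exact hz this.symm
  have hωout : ∀ (y : ElementaryAbelianPoset p G) (Q : Sylow p G),
      (y : Subgroup G) = omegaCenter p (Q : Subgroup G) → y ∉ outside p 𝓜 := fun y Q hy => by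
    obtain ⟨x, hx, hle⟩ := h𝓜.omegaCenter_le Q
    exact not_mem_outside.2 ⟨x, hx, hy ▸ hle⟩
  have hsmulω : ∀ (g : ConjAct G) (y : ElementaryAbelianPoset p G),
      (∃ Q : Sylow p G, (y : Subgroup G) = omegaCenter p (Q : Subgroup G)) →
      ∃ Q : Sylow p G, ((g • y : ElementaryAbelianPoset p G) : Subgroup G) =
        omegaCenter p (Q : Subgroup G) := by
    rintro g y ⟨Q, hQ⟩
    exact ⟨g • Q, by rw [coe_smul, hQ, smul_omegaCenter]; rfl⟩
  have hsmulcard : ∀ (g : ConjAct G) (y : ElementaryAbelianPoset p G),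
      Nat.card ((g • y : ElementaryAbelianPoset p G) : Subgroup G) =
        Nat.card (y : Subgroup G) := fun g y => card_conjAct_smul g _
  have hsmulout : ∀ (g : ConjAct G) (y : ElementaryAbelianPoset p G),
      g • y ∈ outside p 𝓜 → y ∈ outside p 𝓜 := fun g y hy => by
    simpa using h𝓜.smul_mem_outside g⁻¹ hy
  -- Add to each chain not contained in a member of `𝓜` a subgroup of order `p * z`.
  refine HasContractibleOrbits.of_insert (M := ConjAct G)
    (T := {c | (∃ y ∈ c.finset, y ∈ outside p 𝓜) → ∃ y ∈ c.finset, y ∈ outside p 𝓜 ∧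
      Nat.card (y : Subgroup G) = p * z}) (fun _ _ => trivial) (outside p 𝓜)
    {y | y ∈ outside p 𝓜 ∧ Nat.card (y : Subgroup G) = p * z}
    (fun g _ hx => h𝓜.smul_mem_outside g hx)
    (fun g x hx => ⟨h𝓜.smul_mem_outside g hx.1, (hsmulcard g x).trans hx.2⟩) ?_ ?_
    (fun c _ h ⟨y, hy, hy'⟩ => absurd hy' (h y hy))
    (fun c _ _ x hx d hd _ => ⟨x, (hd x).2 (Or.inl rfl), hx⟩) ?_
  · rintro c - ⟨y, hy, hyout⟩
    obtain ⟨C, hC, hCmax⟩ := exists_max_mem_chain c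
    have hCout := outside_of_le (hCmax y hy) hyout
    obtain ⟨Q, hQ⟩ := C.2.2.isPGroup.exists_le_sylow
    refine ⟨⟨C ⊔ omegaCenter p (Q : Subgroup G),
      fun h => C.2.1 (le_bot_iff.1 (le_sup_left.trans h.le)), C.2.2.sup_omegaCenter hQ⟩, ⟨not_le_of_le le_sup_left hCout,
      h𝓜.card_sup_omegaCenter C.2.2 hCout Q hQ⟩, fun w hw => Or.inl ?_⟩
    exact le_trans (b := (C : Subgroup G)) (hCmax w hw) le_sup_left
  · rintro c - ⟨y, hy, hyout⟩ x hx x' hx' hcx hcx'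
    obtain ⟨C, hC, hCmax⟩ := exists_max_mem_chain c
    have hCout := outside_of_le (hCmax y hy) hyout
    obtain ⟨h, hh, hxx'⟩ := h𝓜.exists_conj_of_card hCout x.2.2 x'.2.2 hx.2 hx'.2
      (h𝓜.le_of_card hx.2 hx.1 (hcx C hC)) (h𝓜.le_of_card hx'.2 hx'.1 (hcx' C hC))
    exact ⟨ConjAct.toConjAct h, fun y hy => conj_smul_eq_of_coe_le hh (hCmax y hy),
      Subtype.ext hxx'⟩
  -- Delete the smaller members that lie in no member of `𝓜`.
  refine HasContractibleOrbits.of_filter (M := ConjAct G)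
    (T := {c | ∀ y ∈ c.finset, y ∈ outside p 𝓜 → Nat.card (y : Subgroup G) = p * z})
    (fun c hc ⟨y, hy, hyout⟩ => ⟨y, hy, hyout, hc y hy hyout⟩)
    {y | y ∈ outside p 𝓜 → Nat.card (y : Subgroup G) = p * z}
    (fun g x hx hgx => (hsmulcard g x).trans (hx (hsmulout g x hgx))) ?_
    (fun c hc d hd y hy => ((hd y).1 hy).2) ?_
  · intro c hc
    by_cases h : ∃ y ∈ c.finset, y ∈ outside p 𝓜
    · obtain ⟨y, hy, -, hcard⟩ := hc h
      exact ⟨y, hy, fun _ => hcard⟩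
    · obtain ⟨y, hy⟩ := c.nonempty
      exact ⟨y, hy, fun hout => absurd ⟨y, hy, hout⟩ h⟩
  -- Insert below the remaining member of order `p * z` some `Ω₁(Z(Q))`.
  refine HasContractibleOrbits.of_insert (M := ConjAct G)
    (T := {c | (∀ y ∈ c.finset, y ∈ outside p 𝓜 → Nat.card (y : Subgroup G) = p * z) ∧
      ((∃ y ∈ c.finset, y ∈ outside p 𝓜) → ∃ y ∈ c.finset, y ∉ outside p 𝓜)})
    (fun c hc => hc.1) (outside p 𝓜)
    {y | ∃ Q : Sylow p G, (y : Subgroup G) = omegaCenter p (Q : Subgroup G)}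
    (fun g _ hx => h𝓜.smul_mem_outside g hx) hsmulω ?_ ?_
    (fun c hc h => ⟨hc, fun ⟨y, hy, hy'⟩ => absurd hy' (h y hy)⟩) ?_ ?_
  · rintro c hc ⟨E, hE, hEout⟩
    obtain ⟨C, hCE, hC𝓜, -, hC⟩ := h𝓜.exists_sup_of_not_outside hEout c hE
    obtain ⟨Q, hCQ, hQE⟩ := h𝓜.exists_omegaCenter E E.2.2 hEout (hc E hE hEout) C hCE hC𝓜
    refine ⟨⟨_, hω Q, isElementaryAbelian_omegaCenter _⟩, ⟨Q, rfl⟩, fun y hy => ?_⟩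
    by_cases hyout : y ∈ outside p 𝓜
    · have hyE : y = E := eq_of_comparable (c.comparable ⟨y, hy⟩ ⟨E, hE⟩)
        ((hc y hy hyout).trans (hc E hE hEout).symm)
      exact Or.inr (hyE ▸ hQE)
    · exact Or.inl ((hC y hy hyout).trans hCQ)
  · rintro c hc ⟨E, hE, hEout⟩ x ⟨Q, hx⟩ x' ⟨Q', hx'⟩ hcx hcx'
    have hEcard := hc E hE hEout
    obtain ⟨C, hCE, hC𝓜, hCc, hC⟩ := h𝓜.exists_sup_of_not_outside hEout c hE
    obtain ⟨R, hCR, -⟩ := h𝓜.exists_omegaCenter E E.2.2 hEout hEcard C hCE hC𝓜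
    have hle : ∀ (w : ElementaryAbelianPoset p G) (T : Sylow p G),
        (w : Subgroup G) = omegaCenter p (T : Subgroup G) →
        (∀ y ∈ c.finset, y ≤ w ∨ w ≤ y) → C ≤ omegaCenter p (T : Subgroup G) ∧
          omegaCenter p (T : Subgroup G) ≤ E := by
      intro w T hw hcomp
      rw [← hw]
      refine ⟨?_, (hcomp E hE).elim (fun h => absurd (outside_of_le h hEout) (hωout w T hw)) id⟩
      rcases hCc with rfl | ⟨y, hy, -, rfl⟩
      · exact bot_le
      · refine le_of_comparable (hcomp y hy) ?_
        rw [hw, h𝓜.card_omegaCenter, ← h𝓜.card_omegaCenter R]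
        exact card_le_card_of_le hCR
    obtain ⟨hC₁, hE₁⟩ := hle x Q hx hcx
    obtain ⟨hC₂, hE₂⟩ := hle x' Q' hx' hcx'
    obtain ⟨h, hh, hhE, hQQ'⟩ := exists_conj_omegaCenter_eq h𝓜.card_omegaCenter E.2.2 hEcard
      (h𝓜.omegaCenter_le_of_le E.2.2 hEout hEcard)
      (h𝓜.not_le_centralizer E E.2.2 hEout hEcard) Q Q' hC₁ hC₂ hE₁ hE₂
    refine ⟨ConjAct.toConjAct h, fun y hy => ?_, Subtype.ext ?_⟩
    · by_cases hyout : y ∈ outside p 𝓜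
      · have hyE : y = E := eq_of_comparable (c.comparable ⟨y, hy⟩ ⟨E, hE⟩)
          ((hc y hy hyout).trans hEcard.symm)
        exact hyE ▸ Subtype.ext (conj_smul_eq_of_mem_normalizer hhE)
      · exact conj_smul_eq_of_coe_le hh (hC y hy hyout)
    · rw [coe_smul, hx, hx', hQQ']
  · rintro c hc - x ⟨Q, hx⟩ d hd
    refine ⟨fun y hy hyout => ?_, fun _ => ⟨x, (hd x).2 (Or.inl rfl), hωout x Q hx⟩⟩
    rcases (hd y).1 hy with rfl | hy
    · exact absurd hyout (hωout y Q hx)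
    · exact hc y hy hyout
  -- Delete the members that lie in no member of `𝓜`.
  refine HasContractibleOrbits.of_filter (M := ConjAct G)
    (T := {c | ∀ y ∈ c.finset, y ∉ outside p 𝓜})
    (fun c hc => ⟨fun y hy hyout => absurd hyout (hc y hy),
      fun ⟨y, hy, hyout⟩ => absurd hyout (hc y hy)⟩)
    (outside p 𝓜)ᶜ (fun g x hx hgx => hx (hsmulout g x hgx)) ?_
    (fun c hc d hd y hy => ((hd y).1 hy).2) (h𝓜.hasContractibleOrbits_of_not_outside hne hx₀)
  rintro c ⟨-, hc⟩
  by_cases h : ∃ y ∈ c.finset, y ∈ outside p 𝓜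
  · exact hc h
  · obtain ⟨y, hy⟩ := c.nonempty
    exact ⟨y, hy, fun hout => h ⟨y, hy, hout⟩⟩

end IsControllingFamily

end ControllingFamily

/-! ### The family of centers of Sylow subgroups -/

section Families

variable {G : Type*} [Group G] [Finite G] {p : ℕ} [Fact p.Prime]

theorem exists_sylow_eq_smul (P Q : Sylow p G) :
    ∃ g : ConjAct G, (Q : Subgroup G) = g • (P : Subgroup G) := by
  obtain ⟨h, -, hh⟩ := exists_le_smul_sylow (H := ⊤) P le_top le_top Q.2
  exact ⟨ConjAct.toConjAct h, (Q.is_maximal' (ConjAct.toConjAct h • P : Sylow p G).2 hh).symm⟩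

/-- If no elementary abelian subgroup has order larger than `p * z`, where `z` is the order of the
groups `Ω₁(Z(Q))`, then these groups form a controlling family. -/
theorem isControllingFamily_omegaCenter {z : ℕ}
    (hz : ∀ Q : Sylow p G, Nat.card (omegaCenter p (Q : Subgroup G)) = z)
    (hcard : ∀ E : Subgroup G, IsElementaryAbelian p E → Nat.card E ≤ p * z) :
    IsControllingFamily p z
      {x : Subgroup G | ∃ Q : Sylow p G, x = omegaCenter p (Q : Subgroup G)} := by
  -- A subgroup of the largest possible order contains the elementary abelian subgroups
  -- that centralize it.
  have hmax : ∀ E F : Subgroup G, IsElementaryAbelian p E → IsElementaryAbelian p F →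
      Nat.card E = p * z → F ≤ Subgroup.centralizer (E : Set G) → F ≤ E := by
    intro E F hE hF hEcard hFE
    have : E = F ⊔ E := Subgroup.eq_of_le_of_card_ge le_sup_right
      ((hcard _ (hF.sup hE hFE)).trans hEcard.ge)
    rw [this]
    exact le_sup_left
  have hcent : ∀ (C : Subgroup G) (Q : Sylow p G), C ≤ omegaCenter p (Q : Subgroup G) →
      (Q : Subgroup G) ≤ Subgroup.centralizer (C : Set G) := fun C Q hC =>
    (le_centralizer_omegaCenter _).trans (Subgroup.centralizer_le hC)
  constructor
  · rintro _ ⟨Q, rfl⟩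
    exact isElementaryAbelian_omegaCenter _
  · rintro g _ ⟨Q, rfl⟩
    exact ⟨g • Q, smul_omegaCenter g Q⟩
  · exact hz
  · exact fun Q => ⟨_, ⟨Q, rfl⟩, le_rfl⟩
  · rintro _ ⟨Q, rfl⟩ _ ⟨Q', rfl⟩ C hC hC'
    obtain ⟨h, hh, hQ⟩ := exists_le_smul_sylow Q' (hcent C Q' hC') (hcent C Q hC) Q.2
    refine ⟨h, hh, ?_⟩
    rw [smul_omegaCenter,
      show ConjAct.toConjAct h • (Q' : Subgroup G) = Q from
        Q.is_maximal' (ConjAct.toConjAct h • Q' : Sylow p G).2 hQ]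
  · exact fun E hE _ => hcard E hE
  · rintro E hE - hEcard C hCE ⟨_, ⟨Q, rfl⟩, hCQ⟩
    obtain ⟨h, hh, hEQ⟩ := exists_le_smul_sylow Q (hcent C Q hCQ) (hE.le_centralizer hCE)
      hE.isPGroup
    refine ⟨ConjAct.toConjAct h • Q, ?_, ?_⟩
    · change C ≤ omegaCenter p (ConjAct.toConjAct h • (Q : Subgroup G))
      rw [← smul_omegaCenter, ← conj_smul_eq_of_mem_centralizer le_rfl hh]
      exact Subgroup.pointwise_smul_le_pointwise_smul_iff.2 hCQ
    · exact hmax E _ hE (isElementaryAbelian_omegaCenter _) hEcard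
        (Subgroup.le_centralizer_iff.1 (hEQ.trans (le_centralizer_omegaCenter _)))
  · intro E hE hout hEcard Q hEQ hN
    rcases (inf_le_left : (Q : Subgroup G) ⊓ Subgroup.normalizer (E : Set G) ≤ Q).eq_or_lt
      with heq | hlt
    · exact hout _ ⟨Q, rfl⟩ (hE.le_omegaCenter hEQ (heq ▸ hN))
    · obtain ⟨x, hxQ, hxN, hx⟩ := Q.2.exists_mem_normalizer hlt
      -- The normalizer of `N_Q(E) = C_Q(E)` in `Q` would normalize `E`, its largest elementary
      -- abelian subgroup.
      have hxE : ConjAct.toConjAct x • E ≤ E := by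
        refine hmax E _ hE (hE.smul _) hEcard (le_trans ?_ hN)
        rw [← conj_smul_eq_of_mem_normalizer hx]
        exact Subgroup.pointwise_smul_le_pointwise_smul_iff.2 (le_inf hEQ Subgroup.le_normalizer)
      have hxE' : ConjAct.toConjAct x • E = E :=
        Subgroup.eq_of_le_of_card_ge hxE (card_conjAct_smul _ _).ge
      refine hxN ⟨hxQ, Subgroup.mem_normalizer_iff''.2 fun y => ?_⟩
      rw [← mem_conjAct_smul, hxE']

/-! ### The family of elementary abelian subgroups of order `p ^ 3` -/

section OrderCube

variable {Q : Sylow p G} {A : Subgroup G} (hQ : Nat.card Q = p ^ 4)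
  (hz : Nat.card (omegaCenter p (Q : Subgroup G)) = p) (hA : IsElementaryAbelian p A)
  (hAcard : Nat.card A = p ^ 3) (hAQ : A ≤ Q)

include hQ hz hA hAcard hAQ

/-- In a group `Q` of order `p ^ 4` with `Ω₁(Z(Q))` of order `p`, let `A` be an
elementary abelian subgroup of order `p ^ 3`. An element of `Q` outside `A` generates `Q` together
with `A`, so it centralizes only `Ω₁(Z(Q))` in `A`, and its centralizer in `Q` is small. -/
theorem card_inf_centralizer_le {E : Subgroup G} (hEQ : E ≤ Q) (hEA : ¬ E ≤ A) :
    Nat.card ((Q : Subgroup G) ⊓ Subgroup.centralizer (E : Set G) : Subgroup G) ≤ p ^ 2 := by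
  have hp : 0 < p := (Fact.out : p.Prime).pos
  obtain ⟨y, hyE, hyA⟩ := SetLike.not_le_iff_exists.1 hEA
  set K := (Q : Subgroup G) ⊓ Subgroup.centralizer (E : Set G)
  have hsup : A ⊔ Subgroup.zpowers y = Q := by
    have hle : A ⊔ Subgroup.zpowers y ≤ Q :=
      sup_le hAQ ((Subgroup.zpowers_le).2 (hEQ hyE))
    refine Subgroup.eq_of_le_of_card_ge hle ?_
    have hlt : A < A ⊔ Subgroup.zpowers y := lt_of_le_of_ne le_sup_left fun h =>
      hyA (h.ge (Subgroup.mem_sup_right (Subgroup.mem_zpowers y)))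
    calc Nat.card Q = p * Nat.card A := by rw [hQ, hAcard]; ring
      _ ≤ _ := (Q.2.to_le hle).prime_mul_card_le hlt
  have hB : A ⊓ K ≤ omegaCenter p (Q : Subgroup G) := by
    refine (hA.mono inf_le_left).le_omegaCenter (inf_le_left.trans hAQ) ?_
    rw [← hsup]
    refine sup_le (hA.le_centralizer inf_le_left) ((Subgroup.zpowers_le).2 ?_)
    refine Subgroup.mem_centralizer_iff.2 fun b hb => ?_
    exact (Subgroup.mem_centralizer_iff.1 hb.2.2 y hyE).symm
  have hBcard : Nat.card (A ⊓ K : Subgroup G) ≤ p := (card_le_card_of_le hB).trans hz.le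
  have hindex : A.relIndex Q = p := by
    have := card_mul_relIndex hAQ
    rw [hAcard, hQ, pow_succ p 3] at this
    exact Nat.eq_of_mul_eq_mul_left (pow_pos hp 3) this
  have hrel : (A ⊓ K).relIndex K ≤ p := by
    rw [Subgroup.inf_relIndex_right, ← hindex]
    exact Subgroup.relIndex_le_of_le_right inf_le_left (hindex.trans_ne hp.ne')
  calc Nat.card K = Nat.card (A ⊓ K : Subgroup G) * (A ⊓ K).relIndex K :=
        (card_mul_relIndex inf_le_right).symm
    _ ≤ p * p := Nat.mul_le_mul hBcard hrel
    _ = p ^ 2 := (sq p).symm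

theorem eq_of_card_eq_cube {A' : Subgroup G} (hA' : IsElementaryAbelian p A')
    (hAcard' : Nat.card A' = p ^ 3) (hAQ' : A' ≤ Q) : A' = A := by
  by_contra hne
  have hle : ¬ A' ≤ A := fun h => hne (Subgroup.eq_of_le_of_card_ge h (by rw [hAcard, hAcard']))
  have h₁ := card_inf_centralizer_le hQ hz hA hAcard hAQ hAQ' hle
  have h₂ := (card_le_card_of_le (le_inf hAQ' (hA'.le_centralizer le_rfl))).trans h₁
  rw [hAcard'] at h₂
  exact absurd h₂ (not_le.2 (Nat.pow_lt_pow_right (Fact.out : p.Prime).one_lt (by norm_num)))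

theorem omegaCenter_le_of_card_eq_cube : omegaCenter p (Q : Subgroup G) ≤ A := by
  by_contra hle
  have h₁ := card_inf_centralizer_le hQ hz hA hAcard hAQ (omegaCenter_le _) hle
  have h₂ := (card_le_card_of_le (le_inf le_rfl (le_centralizer_omegaCenter _))).trans h₁
  rw [hQ] at h₂
  exact absurd h₂ (not_le.2 (Nat.pow_lt_pow_right (Fact.out : p.Prime).one_lt (by norm_num)))

end OrderCube

/-- If the Sylow subgroups have order `p ^ 4`, centers with `Ω₁` of order `p`, and contain
elementary abelian subgroups of order `p ^ 3`, then the latter form a controlling family. -/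
theorem isControllingFamily_card_eq_cube (hQ : ∀ Q : Sylow p G, Nat.card Q = p ^ 4)
    (hz : ∀ Q : Sylow p G, Nat.card (omegaCenter p (Q : Subgroup G)) = p)
    (hA : ∀ Q : Sylow p G, ∃ A : Subgroup G, IsElementaryAbelian p A ∧ Nat.card A = p ^ 3 ∧
      A ≤ Q) :
    IsControllingFamily p p {x : Subgroup G | IsElementaryAbelian p x ∧ Nat.card x = p ^ 3} := by
  have hp : p.Prime := Fact.out
  have hcent : ∀ E : Subgroup G,
      (∀ x ∈ {x : Subgroup G | IsElementaryAbelian p x ∧ Nat.card x = p ^ 3}, ¬ E ≤ x) →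
      ∀ Q : Sylow p G, E ≤ Q →
        Nat.card ((Q : Subgroup G) ⊓ Subgroup.centralizer (E : Set G) : Subgroup G) ≤ p ^ 2 := by
    intro E hout Q hEQ
    obtain ⟨A, hA, hAcard, hAQ⟩ := hA Q
    exact card_inf_centralizer_le (hQ Q) (hz Q) hA hAcard hAQ hEQ (hout A ⟨hA, hAcard⟩)
  -- A subgroup of order `p ^ 2` in no member of the family is its own centralizer in `Q`.
  have hself : ∀ E : Subgroup G, IsElementaryAbelian p E →
      (∀ x ∈ {x : Subgroup G | IsElementaryAbelian p x ∧ Nat.card x = p ^ 3}, ¬ E ≤ x) →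
      Nat.card E = p * p → ∀ Q : Sylow p G, E ≤ Q →
        (Q : Subgroup G) ⊓ Subgroup.centralizer (E : Set G) = E := fun E hE hout hEcard Q hEQ =>
    (Subgroup.eq_of_le_of_card_ge (le_inf hEQ (hE.le_centralizer le_rfl))
      ((hcent E hout Q hEQ).trans (by rw [hEcard, sq]))).symm
  constructor
  · exact fun x hx => hx.1
  · exact fun g x hx => ⟨hx.1.smul g, (card_conjAct_smul g x).trans hx.2⟩
  · exact hz
  · intro Q
    obtain ⟨A, hA, hAcard, hAQ⟩ := hA Q
    exact ⟨A, ⟨hA, hAcard⟩, omegaCenter_le_of_card_eq_cube (hQ Q) (hz Q) hA hAcard hAQ⟩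
  · rintro x ⟨hx, hxcard⟩ x' ⟨hx', hxcard'⟩ C hC hC'
    obtain ⟨h, hh, S, -, hS, hxS, hxS'⟩ := exists_common_isPGroup
      (hx.le_centralizer hC) (hx'.le_centralizer hC') hx.isPGroup hx'.isPGroup
    obtain ⟨Q, hSQ⟩ := hS.exists_le_sylow
    exact ⟨h, hh, eq_of_card_eq_cube (hQ Q) (hz Q) hx hxcard (hxS.trans hSQ) (hx'.smul _)
      ((card_conjAct_smul _ _).trans hxcard') (hxS'.trans hSQ)⟩
  · intro E hE hout
    obtain ⟨Q, hEQ⟩ := hE.isPGroup.exists_le_sylow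
    rw [← sq]
    exact (card_le_card_of_le (le_inf hEQ (hE.le_centralizer le_rfl))).trans (hcent E hout Q hEQ)
  · rintro E hE hout hEcard C hCE ⟨A, ⟨hA, hAcard⟩, hCA⟩
    obtain ⟨h, -, S, hSC, hS, hES, hAS⟩ := exists_common_isPGroup
      (hE.le_centralizer hCE) (hA.le_centralizer hCA) hE.isPGroup hA.isPGroup
    obtain ⟨Q, hSQ⟩ := hS.exists_le_sylow
    have hE_eq := hself E hE hout hEcard Q (hES.trans hSQ)
    have hQE : omegaCenter p (Q : Subgroup G) ≤ E := hE_eq ▸ le_inf (omegaCenter_le _)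
      (Subgroup.le_centralizer_iff.1 ((hES.trans hSQ).trans (le_centralizer_omegaCenter _)))
    refine ⟨Q, ?_, hQE⟩
    have hSE : ¬ S ≤ E := fun hle => by
      have := card_le_card_of_le (hAS.trans hle)
      rw [card_conjAct_smul, hAcard, hEcard, ← sq] at this
      exact absurd this (not_le.2 (Nat.pow_lt_pow_right hp.one_lt (by norm_num)))
    obtain ⟨x, hxS, hxE⟩ := SetLike.not_le_iff_exists.1 hSE
    -- The fixed points of `x` on `E` have order `p`, and contain both `C` and `Ω₁(Z(Q))`.
    set F := E ⊓ Subgroup.centralizer {x}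
    have hQF : omegaCenter p (Q : Subgroup G) ≤ F := le_inf hQE fun w hw =>
      Subgroup.mem_centralizer_singleton_iff.2
        (Subgroup.mem_centralizer_iff.1 (le_centralizer_omegaCenter _ (hSQ hxS)) w hw)
    have hCF : C ≤ F := le_inf hCE fun w hw =>
      Subgroup.mem_centralizer_singleton_iff.2 (Subgroup.mem_centralizer_iff.1 (hSC hxS) w hw)
    have hFE : F < E := lt_of_le_of_ne inf_le_left fun heq => hxE <| by
      rw [← hE_eq]
      refine ⟨hSQ hxS, Subgroup.mem_centralizer_iff.2 fun w hw => ?_⟩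
      rw [← heq] at hw
      exact Subgroup.mem_centralizer_singleton_iff.1 hw.2
    have hFcard : Nat.card F ≤ p := by
      have := hE.isPGroup.prime_mul_card_le hFE
      rw [hEcard] at this
      exact Nat.le_of_mul_le_mul_left this hp.pos
    rw [Subgroup.eq_of_le_of_card_ge hQF (hFcard.trans (hz Q).ge)]
    exact hCF
  · intro E hE hout hEcard Q hEQ hN
    have hlt : E < Q := lt_of_le_of_ne hEQ fun heq => by
      have h4 := hQ Q
      rw [← heq, hEcard, ← sq] at h4
      exact absurd (Nat.pow_right_injective hp.two_le h4) (by norm_num)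
    obtain ⟨x, hxQ, hxE, hx⟩ := Q.2.exists_mem_normalizer hlt
    rw [← hself E hE hout hEcard Q hEQ] at hxE
    exact hxE ⟨hxQ, hN ⟨hxQ, hx⟩⟩

/-! ### Sylow subgroups of order at most `p ^ 4` -/

/-- If some elementary abelian subgroup `E` has order larger than `p * |Ω₁(Z(P))|`, then comparing
powers of `p` leaves only `|E| = p ^ 3`, `|P| = p ^ 4` and `|Ω₁(Z(P))| = p`. -/
theorem exists_isControllingFamily (hpG : p ∣ Nat.card G) (P : Sylow p G)
    (hP : Nat.card P ≤ p ^ 4) : ∃ z ≠ 1, ∃ 𝓜 : Set (Subgroup G),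
      IsControllingFamily p z 𝓜 ∧ ∀ x ∈ 𝓜, x ≠ ⊥ := by
  have hp : p.Prime := Fact.out
  have hPω : omegaCenter p (P : Subgroup G) ≠ ⊥ :=
    omegaCenter_ne_bot P.2 (P.ne_bot_of_dvd_card hpG)
  have hz1 : Nat.card (omegaCenter p (P : Subgroup G)) ≠ 1 := fun h =>
    hPω (Subgroup.card_eq_one.1 h)
  have hne : ∀ x : Subgroup G, Nat.card x ≠ 1 → x ≠ ⊥ := by
    rintro _ h rfl
    exact h Subgroup.card_bot
  by_cases hb : ∀ E : Subgroup G, IsElementaryAbelian p E →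
      Nat.card E ≤ p * Nat.card (omegaCenter p (P : Subgroup G))
  · refine ⟨_, hz1, _, isControllingFamily_omegaCenter (fun Q => card_omegaCenter_eq Q P) hb, ?_⟩
    rintro _ ⟨Q, rfl⟩
    exact hne _ (card_omegaCenter_eq Q P ▸ hz1)
  · push Not at hb
    obtain ⟨E, hE, hlt⟩ := hb
    obtain ⟨Q, hEQ⟩ := hE.isPGroup.exists_le_sylow
    have hcardQ : ∀ R : Sylow p G, Nat.card R = Nat.card Q := fun R => by
      obtain ⟨g, hg⟩ := exists_sylow_eq_smul Q R
      rw [hg, card_conjAct_smul]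
    rw [card_omegaCenter_eq P Q] at hlt hz1
    have hEneQ : E ≠ Q := by
      rintro heq
      rw [← heq, hE.omegaCenter_eq] at hlt
      exact absurd hlt (not_lt.2 (Nat.le_mul_of_pos_left _ hp.pos))
    have hQE := Q.2.prime_mul_card_le (lt_of_le_of_ne hEQ hEneQ)
    obtain ⟨a, ha⟩ := IsPGroup.iff_card.1 (isElementaryAbelian_omegaCenter (p := p)
      (Q : Subgroup G)).isPGroup
    obtain ⟨b, hb⟩ := IsPGroup.iff_card.1 hE.isPGroup
    obtain ⟨c, hc⟩ := IsPGroup.iff_card.1 Q.2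
    have hc' : Nat.card Q = p ^ c := hc
    rw [hcardQ P, hc', Nat.pow_le_pow_iff_right hp.one_lt] at hP
    rw [hb, hc, ← pow_succ', Nat.pow_le_pow_iff_right hp.one_lt] at hQE
    rw [ha, hb, ← pow_succ', Nat.pow_lt_pow_iff_right hp.one_lt] at hlt
    have ha0 : a ≠ 0 := by
      rintro rfl
      exact hz1 (by rw [ha, pow_zero])
    obtain rfl : a = 1 := by omega
    obtain rfl : b = 3 := by omega
    obtain rfl : c = 4 := by omega
    refine ⟨p, hp.one_lt.ne', _, isControllingFamily_card_eq_cube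
      (fun R => (hcardQ R).trans hc')
      (fun R => (card_omegaCenter_eq R Q).trans (ha.trans (pow_one p))) (fun R => ?_), ?_⟩
    · obtain ⟨g, hg⟩ := exists_sylow_eq_smul Q R
      refine ⟨g • E, hE.smul g, (card_conjAct_smul g E).trans hb, ?_⟩
      rw [hg]
      exact Subgroup.pointwise_smul_le_pointwise_smul_iff.2 hEQ
    · rintro x ⟨-, hx⟩
      refine hne x ?_
      rw [hx]
      exact (Nat.one_lt_pow (by norm_num) hp.one_lt).ne'

end Families

instance finite_nonemptyFiniteChains {X : Type*} [PartialOrder X] [Finite X] :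
    Finite (NonemptyFiniteChains X) :=
  Finite.of_injective NonemptyFiniteChains.finset fun _ _ => NonemptyFiniteChains.ext

end OrbitPosets

theorem mainTheorem4 {G : Type*} [Group G] [Finite G] (p : ℕ) [Fact p.Prime]
    (hp : p ∣ Nat.card G) (P : Sylow p G) (hP : Nat.card P ≤ p ^ 4) :
    Finite (OrbitPosets.SubdivisionOrbitSpace p G) ∧
      ContractibleSpace (OrbitPosets.SubdivisionOrbitSpace p G) := by
  constructor
  · exact Quotient.finite (MulAction.orbitRel (ConjAct G)
      (NonemptyFiniteChains (OrbitPosets.ElementaryAbelianPoset p G)))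
  · obtain ⟨z, hz, 𝓜, h𝓜, hne⟩ := OrbitPosets.exists_isControllingFamily hp P hP
    have hsurj : ∀ o, o ∈ OrbitPosets.OrbitPoset.mk (ConjAct G) '' (Set.univ :
        Set (NonemptyFiniteChains (OrbitPosets.ElementaryAbelianPoset p G))) := fun o => by
      obtain ⟨c, rfl⟩ := Quotient.exists_rep o
      exact ⟨c, trivial, rfl⟩
    exact OrbitPosets.contractibleSpace_of_comparable
      ⟨fun o => ⟨o, hsurj o⟩, fun _ _ h => h⟩ ⟨Subtype.val, fun _ _ h => h⟩
      (Or.inl fun _ => le_rfl) (Or.inl fun _ => le_rfl)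
      (h𝓜.hasContractibleOrbits_univ hz hne)
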